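/- Let $G$ be a compact Lie group and let $\pi : P \to \Sigma$ be a smooth principal $G$-bundle over a smooth surface $\Sigma$ of genus $1$ (that is, $\Sigma$ is diffeomorphic to the $2$-dimensional torus). Let $\mathrm{Aut}(P)$ be the group of $G$-equivariant diffeomorphisms $P \to P$ covering a diffeomorphism of $\Sigma$, with the compact-open topology. Let $\gamma : \mathbb{C} \to \mathrm{Aut}(P)$ be a frame in $P$, that is, a continuous group homomorphism such that the induced action of $\mathbb{C}$ on $\Sigma$ is transitive. Then the closure $\overline{\gamma(\mathbb{C})}$ of the image of $\gamma$ in $\mathrm{Aut}(P)$ is compact. Moreover, there is a torus $T \leq \mathrm{Aut}(P)$ (a closed subgroup isomorphic, as a topological group, to $(S^1)^n$ for some $n \geq 0$) such that $\gamma(\mathbb{C}) \subseteq T$, so that $\gamma$ factors through $T$. -/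

import Mathlib

open scoped Manifold ContDiff

/-- A smooth (right) principal `G`-bundle `proj : P → S`. The manifolds are modelled on `IG`, `IP`
and `IS`. -/
structure SmoothPrincipalBundle
    {EG HG EP HP ES HS : Type*}
    [NormedAddCommGroup EG] [NormedSpace ℝ EG] [TopologicalSpace HG]
    [NormedAddCommGroup EP] [NormedSpace ℝ EP] [TopologicalSpace HP]
    [NormedAddCommGroup ES] [NormedSpace ℝ ES] [TopologicalSpace HS]
    (IG : ModelWithCorners ℝ EG HG) (IP : ModelWithCorners ℝ EP HP) (IS : ModelWithCorners ℝ ES HS)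
    (G P S : Type*)
    [TopologicalSpace G] [ChartedSpace HG G] [Group G]
    [TopologicalSpace P] [ChartedSpace HP P]
    [TopologicalSpace S] [ChartedSpace HS S] where
  /-- the bundle projection -/
  proj : P → S
  /-- the right action of the structure group on the total space, `act p g = p · g` -/
  act : P → G → P
  act_one : ∀ p, act p 1 = p
  act_mul : ∀ p g h, act p (g * h) = act (act p g) h
  contMDiff_proj : ContMDiff IP IS ∞ proj
  contMDiff_act : ContMDiff (IP.prod IG) IP ∞ (fun q : P × G => act q.1 q.2)
  proj_act : ∀ p g, proj (act p g) = proj p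
  /-- around every point of the base there is a smooth `G`-equivariant local trivialization -/
  locally_trivial : ∀ b : S, ∃ e : Bundle.Trivialization G proj, b ∈ e.baseSet ∧
    ContMDiffOn IP (IS.prod IG) ∞ e e.source ∧
    ContMDiffOn (IS.prod IG) IP ∞ e.toOpenPartialHomeomorph.symm e.target ∧
    ∀ p ∈ e.source, ∀ g : G, (e (act p g)).2 = (e p).2 * g

section

variable
    {EG HG EP HP ES HS : Type*}
    [NormedAddCommGroup EG] [NormedSpace ℝ EG] [TopologicalSpace HG]
    [NormedAddCommGroup EP] [NormedSpace ℝ EP] [TopologicalSpace HP]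
    [NormedAddCommGroup ES] [NormedSpace ℝ ES] [TopologicalSpace HS]
    {IG : ModelWithCorners ℝ EG HG} {IP : ModelWithCorners ℝ EP HP} {IS : ModelWithCorners ℝ ES HS}
    {G P S : Type*}
    [TopologicalSpace G] [ChartedSpace HG G] [Group G]
    [TopologicalSpace P] [ChartedSpace HP P]
    [TopologicalSpace S] [ChartedSpace HS S]

/-- An automorphism of a principal bundle: a `G`-equivariant diffeomorphism of the total space
covering a diffeomorphism of the base. -/
structure BundleAut (ξ : SmoothPrincipalBundle IG IP IS G P S) where
  toDiffeo : P ≃ₘ⟮IP, IP⟯ P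
  /-- the diffeomorphism of the base that is covered -/
  baseDiffeo : S ≃ₘ⟮IS, IS⟯ S
  map_act : ∀ p g, toDiffeo (ξ.act p g) = ξ.act (toDiffeo p) g
  covers : ∀ p, ξ.proj (toDiffeo p) = baseDiffeo (ξ.proj p)

namespace BundleAut

variable {ξ : SmoothPrincipalBundle IG IP IS G P S}

theorem proj_surjective (ξ : SmoothPrincipalBundle IG IP IS G P S) :
    Function.Surjective ξ.proj := by
  intro b
  obtain ⟨e, hb, -⟩ := ξ.locally_trivial b
  exact ⟨e.toOpenPartialHomeomorph.symm (b, 1), e.proj_symm_apply' hb⟩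

/-- An automorphism is determined by its map on the total space. -/
theorem ext_total {f g : BundleAut ξ} (h : ∀ p, f.toDiffeo p = g.toDiffeo p) : f = g := by
  have h1 : f.toDiffeo = g.toDiffeo := Diffeomorph.ext h
  have h2 : f.baseDiffeo = g.baseDiffeo := by
    refine Diffeomorph.ext fun b => ?_
    obtain ⟨p, rfl⟩ := proj_surjective ξ b
    rw [← f.covers, ← g.covers, h]
  cases f
  cases g
  simp_all

/-- The group of bundle automorphisms, with composition as multiplication. -/
noncomputable instance : Group (BundleAut ξ) where
  mul f g :=
    { toDiffeo := g.toDiffeo.trans f.toDiffeo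
      baseDiffeo := g.baseDiffeo.trans f.baseDiffeo
      map_act := fun p x => by simp [g.map_act, f.map_act]
      covers := fun p => by simp [g.covers, f.covers] }
  one :=
    { toDiffeo := Diffeomorph.refl IP P ∞
      baseDiffeo := Diffeomorph.refl IS S ∞
      map_act := fun p x => by simp
      covers := fun p => by simp }
  inv f :=
    { toDiffeo := f.toDiffeo.symm
      baseDiffeo := f.baseDiffeo.symm
      map_act := fun p x => f.toDiffeo.injective (by simp [f.map_act])
      covers := fun p => f.baseDiffeo.injective (by simp [← f.covers]) }
  mul_assoc _ _ _ := rfl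
  one_mul _ := rfl
  mul_one _ := rfl
  inv_mul_cancel f := ext_total fun p => f.toDiffeo.symm_apply_apply p

/-- The underlying continuous map of the total space. -/
noncomputable def toContinuousMap (f : BundleAut ξ) : C(P, P) :=
  ⟨f.toDiffeo, f.toDiffeo.continuous⟩

/-- The compact-open topology on the automorphism group: the topology induced from `C(P, P)`. -/
noncomputable instance : TopologicalSpace (BundleAut ξ) :=
  TopologicalSpace.induced toContinuousMap inferInstance

end BundleAut

/-- A frame: a continuous homomorphism `γ : ℂ → Aut(P)` such that the induced action of `ℂ` on the
base is transitive. -/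
def IsFrame {ξ : SmoothPrincipalBundle IG IP IS G P S}
    (γ : Multiplicative ℂ →ₜ* BundleAut ξ) : Prop :=
  ∀ b b' : S, ∃ z : ℂ, (γ (Multiplicative.ofAdd z)).baseDiffeo b = b'

end

/-- A smooth surface of genus one: a smooth manifold diffeomorphic to the standard
two-dimensional torus. -/
def IsGenusOneSurface {ES HS : Type*} [NormedAddCommGroup ES] [NormedSpace ℝ ES]
    [TopologicalSpace HS] (IS : ModelWithCorners ℝ ES HS) (S : Type*) [TopologicalSpace S]
    [ChartedSpace HS S] : Prop :=
  IsManifold IS ∞ S ∧ Nonempty (S ≃ₘ⟮IS, (𝓡 1).prod (𝓡 1)⟯ (Circle × Circle))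

/-- A topological group is a torus if it is isomorphic, as a topological group, to a finite power
of the circle group. -/
def IsTorusGroup (T : Type*) [Group T] [TopologicalSpace T] : Prop :=
  ∃ n : ℕ, Nonempty (T ≃ₜ* (Fin n → Circle))

/-!
Fix a point `p₀` of the bundle and let `Λ` be the group of periods: the vectors `l` for which `γ(l)`
fixes the fibre of `p₀`. Then `γ(l) p₀ = p₀ · h(l)` defines the holonomy `h : Λ → G`; let `H` be the
closure of its image, a compact abelian group. Every point of the bundle has the form
`γ(z) p₀ · g`, uniquely up to periods, so each `η ∈ H` acts by the twist
`γ(z) p₀ · g ↦ γ(z) p₀ · ηg`, which commutes with `γ`. The twist by `h(l)` is `γ(l)`, hence smooth,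
and every other twist is smooth because in a faithful representation `ρ` of `G` the matrix `ρ(η)` is
a linear combination of the `ρ(h(l))`.

The group `K` generated by `γ` and the twists is the quotient of `E × H` by the graph
`{(l, h(l)⁻¹) | l ∈ Λ}`. It is compact because the translates of a compact set under `Λ` cover `E`.
Its character group is finitely generated, as `H` is a matrix group and `Λ` is a lattice modulo its
lineality space, and torsion-free, as the divisible group `γ(E)` is dense in `K`.
A compact abelian group with such a character group is a torus.
-/

open scoped Topology
open MeasureTheory

section ParametricIntegral

variable {E F : Type*} [NormedAddCommGroup E] [NormedSpace ℝ E]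
  [NormedAddCommGroup F] [NormedSpace ℝ F]
  {EY HY Y : Type*} [NormedAddCommGroup EY] [NormedSpace ℝ EY] [TopologicalSpace HY]
  {IY : ModelWithCorners ℝ EY HY} [TopologicalSpace Y] [ChartedSpace HY Y]
  {φ : E → Y → F} {U : Set E}

theorem contMDiffOn_partial_fderiv [IsManifold IY ∞ Y] (hU : IsOpen U)
    (hφ : ContMDiffOn (𝓘(ℝ, E).prod IY) 𝓘(ℝ, F) ∞ (fun q : E × Y => φ q.1 q.2) (U ×ˢ Set.univ)) :
    ContMDiffOn (𝓘(ℝ, E).prod IY) 𝓘(ℝ, E →L[ℝ] F) ∞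
      (fun q : E × Y => fderiv ℝ (φ · q.2) q.1) (U ×ˢ Set.univ) := by
  intro q hq
  have hφq : ContMDiffAt (𝓘(ℝ, E).prod IY) 𝓘(ℝ, F) ∞ (fun q : E × Y => φ q.1 q.2) (q.1, q.2) :=
    (hφ q hq).contMDiffAt ((hU.prod isOpen_univ).mem_nhds hq)
  have hcomp : ContMDiffAt ((𝓘(ℝ, E).prod IY).prod 𝓘(ℝ, E)) 𝓘(ℝ, F) ∞
      (Function.uncurry fun (n : E × Y) (m : E) => φ m n.2) (q, q.1) :=
    ContMDiffAt.comp (x := (q, q.1)) (f := fun r : (E × Y) × E => (r.2, r.1.2))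
      (g := fun q : E × Y => φ q.1 q.2) hφq
      (contMDiffAt_snd.prodMk (contMDiffAt_snd.comp _ contMDiffAt_fst))
  have hmfderiv := ContMDiffAt.mfderiv (fun (n : E × Y) (m : E) => φ m n.2) Prod.fst hcomp
    contMDiffAt_fst (m := ∞) (by simp)
  refine ContMDiffAt.contMDiffWithinAt ?_
  convert! hmfderiv using 1
  ext r : 1
  simp [inTangentCoordinates_model_space, mfderiv_eq_fderiv]

theorem differentiableAt_of_contMDiffOn_prod (hU : IsOpen U)
    (hφ : ContMDiffOn (𝓘(ℝ, E).prod IY) 𝓘(ℝ, F) ∞ (fun q : E × Y => φ q.1 q.2) (U ×ˢ Set.univ))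
    {x : E} (hx : x ∈ U) (y : Y) : DifferentiableAt ℝ (φ · y) x := by
  have hφxy : ContMDiffAt (𝓘(ℝ, E).prod IY) 𝓘(ℝ, F) ∞ (fun q : E × Y => φ q.1 q.2) (x, y) :=
    (hφ (x, y) ⟨hx, trivial⟩).contMDiffAt ((hU.prod isOpen_univ).mem_nhds ⟨hx, trivial⟩)
  have hslice : ContMDiffAt 𝓘(ℝ, E) 𝓘(ℝ, F) ∞ (φ · y) x :=
    ContMDiffAt.comp (x := x) (f := fun u : E => (u, y)) (g := fun q : E × Y => φ q.1 q.2) hφxy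
      (contMDiffAt_id.prodMk contMDiffAt_const)
  exact (contMDiffAt_iff_contDiffAt.1 hslice).differentiableAt (by simp)

theorem continuous_slice {X Y F : Type*} [TopologicalSpace X] [TopologicalSpace Y]
    [TopologicalSpace F] {ψ : X × Y → F} {U : Set X} (hψ : ContinuousOn ψ (U ×ˢ Set.univ)) {x : X}
    (hx : x ∈ U) : Continuous fun y => ψ (x, y) :=
  hψ.comp_continuous (by fun_prop) fun _ => ⟨hx, trivial⟩

theorem exists_bound_of_continuousOn_prod {X Y F : Type*} [TopologicalSpace X]
    [LocallyCompactSpace X] [TopologicalSpace Y] [CompactSpace Y] [SeminormedAddCommGroup F]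
    {ψ : X × Y → F} {U : Set X} (hU : IsOpen U) (hψ : ContinuousOn ψ (U ×ˢ Set.univ)) {u : X}
    (hu : u ∈ U) : ∃ s ∈ 𝓝 u, s ⊆ U ∧ ∃ C : ℝ, ∀ x ∈ s, ∀ y, ‖ψ (x, y)‖ ≤ C := by
  obtain ⟨s, hs, hsU, hsc⟩ := local_compact_nhds (hU.mem_nhds hu)
  obtain ⟨C, hC⟩ := ((hsc.prod isCompact_univ).image_of_continuousOn
    (hψ.mono (Set.prod_mono hsU le_rfl))).isBounded.exists_norm_le
  exact ⟨s, hs, hsU, C, fun x hx y => hC _ ⟨(x, y), ⟨hx, trivial⟩, rfl⟩⟩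

theorem integrable_smul_of_continuous {𝕜 Y F : Type*} [RCLike 𝕜] [TopologicalSpace Y]
    [CompactSpace Y] [MeasurableSpace Y] [BorelSpace Y] {μ : Measure Y} {w : Y → 𝕜}
    [NormedAddCommGroup F] [NormedSpace 𝕜 F] (hw : Integrable w μ) {f : Y → F}
    (hf : Continuous f) : Integrable (fun y => w y • f y) μ := by
  obtain ⟨C, hC⟩ := (isCompact_range hf).isBounded.exists_norm_le
  exact hw.smul_bdd C
    (hf.stronglyMeasurable_of_hasCompactSupport (.of_compactSpace f)).aestronglyMeasurable
    (Filter.Eventually.of_forall fun y => hC _ (Set.mem_range_self y))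

variable {𝕜 : Type*} [RCLike 𝕜] [NormedSpace 𝕜 F] [IsScalarTower ℝ 𝕜 F] [IsManifold IY ∞ Y]
  [FiniteDimensional ℝ E] [CompactSpace Y] [MeasurableSpace Y] [BorelSpace Y] {μ : Measure Y}
  {w : Y → 𝕜}

theorem hasFDerivAt_integral_smul (hw : Integrable w μ) (hU : IsOpen U)
    (hφ : ContMDiffOn (𝓘(ℝ, E).prod IY) 𝓘(ℝ, F) ∞ (fun q : E × Y => φ q.1 q.2) (U ×ˢ Set.univ))
    {u : E} (hu : u ∈ U) :
    HasFDerivAt (fun x => ∫ y, w y • φ x y ∂μ) (∫ y, w y • fderiv ℝ (φ · y) u ∂μ) u := by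
  have hφ' := contMDiffOn_partial_fderiv hU hφ
  have slice_integrable : ∀ x ∈ U, Integrable (fun y => w y • φ x y) μ := fun x hx =>
    integrable_smul_of_continuous hw <| continuous_slice hφ.continuousOn hx
  have fderiv_integrable : Integrable (fun y => w y • fderiv ℝ (φ · y) u) μ :=
    integrable_smul_of_continuous hw <| continuous_slice hφ'.continuousOn hu
  obtain ⟨s, hs, hsU, C, hC⟩ := exists_bound_of_continuousOn_prod hU hφ'.continuousOn hu
  refine hasFDerivAt_integral_of_dominated_of_fderiv_le (𝕜 := ℝ) (bound := fun y => ‖w y‖ * C)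
    (F' := fun x y => w y • fderiv ℝ (φ · y) x) hs ?_ (slice_integrable u hu)
    fderiv_integrable.aestronglyMeasurable (.of_forall fun y x hx => ?_) (hw.norm.mul_const C)
    (.of_forall fun y x hx => ?_)
  · filter_upwards [hU.mem_nhds hu] with x hx using (slice_integrable x hx).aestronglyMeasurable
  · rw [norm_smul]
    exact mul_le_mul_of_nonneg_left (hC x hx y) (norm_nonneg _)
  · exact (differentiableAt_of_contMDiffOn_prod hU hφ (hsU hx) y).hasFDerivAt.const_smul (w y)

theorem fderiv_integral_smul_apply (hw : Integrable w μ) (hU : IsOpen U)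
    (hφ : ContMDiffOn (𝓘(ℝ, E).prod IY) 𝓘(ℝ, F) ∞ (fun q : E × Y => φ q.1 q.2) (U ×ˢ Set.univ))
    {u : E} (hu : u ∈ U) (v : E) :
    fderiv ℝ (fun x => ∫ y, w y • φ x y ∂μ) u v = ∫ y, w y • fderiv ℝ (φ · y) u v ∂μ := by
  rw [(hasFDerivAt_integral_smul hw hU hφ hu).fderiv, ContinuousLinearMap.integral_apply]
  · rfl
  · exact integrable_smul_of_continuous hw <|
      continuous_slice (contMDiffOn_partial_fderiv hU hφ).continuousOn hu

theorem contDiffOn_integral_smul (hw : Integrable w μ) (hU : IsOpen U)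
    (hφ : ContMDiffOn (𝓘(ℝ, E).prod IY) 𝓘(ℝ, F) ∞ (fun q : E × Y => φ q.1 q.2) (U ×ˢ Set.univ)) :
    ContDiffOn ℝ ∞ (fun u => ∫ y, w y • φ u y ∂μ) U := by
  refine contDiffOn_infty.2 fun n => ?_
  induction n generalizing φ with
  | zero =>
    exact contDiffOn_zero.2 fun u hu =>
      (hasFDerivAt_integral_smul hw hU hφ hu).continuousAt.continuousWithinAt
  | succ n ih =>
    push_cast
    rw [contDiffOn_succ_iff_fderiv_of_isOpen hU]
    refine ⟨fun u hu =>
        (hasFDerivAt_integral_smul hw hU hφ hu).differentiableAt.differentiableWithinAt,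
      by simp, contDiffOn_clm_apply.2 fun v => ?_⟩
    have hv : ContMDiffOn (𝓘(ℝ, E).prod IY) 𝓘(ℝ, F) ∞
        (fun q : E × Y => fderiv ℝ (φ · q.2) q.1 v) (U ×ˢ Set.univ) :=
      (contMDiffOn_partial_fderiv hU hφ).clm_apply contMDiffOn_const
    exact (ih hv).congr fun u hu => fderiv_integral_smul_apply hw hU hφ hu v

theorem contMDiff_integral_smul {HM M : Type*} [TopologicalSpace HM] {IM : ModelWithCorners ℝ E HM}
    [IM.Boundaryless] [TopologicalSpace M] [ChartedSpace HM M] [IsManifold IM ∞ M]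
    (hw : Integrable w μ) {Φ : M → Y → F}
    (hΦ : ContMDiff (IM.prod IY) 𝓘(ℝ, F) ∞ (fun q : M × Y => Φ q.1 q.2)) :
    ContMDiff IM 𝓘(ℝ, F) ∞ (fun x => ∫ y, w y • Φ x y ∂μ) := by
  intro x
  have hchart : ContMDiffOn (𝓘(ℝ, E).prod IY) 𝓘(ℝ, F) ∞
      (fun q : E × Y => Φ ((extChartAt IM x).symm q.1) q.2)
      ((extChartAt IM x).target ×ˢ Set.univ) :=
    hΦ.comp_contMDiffOn (ContMDiffOn.prodMk
      ((contMDiffOn_extChartAt_symm x).comp contMDiffOn_fst fun q hq => hq.1) contMDiffOn_snd)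
  have hcomp := (contMDiffOn_iff_contDiffOn.2
    (contDiffOn_integral_smul (φ := fun u => Φ ((extChartAt IM x).symm u)) hw
      (isOpen_extChartAt_target x) hchart)).comp
    (contMDiffOn_extChartAt (I := IM) (x := x))
    fun y hy => (extChartAt IM x).map_source (by simpa using hy)
  refine (hcomp.congr fun y hy => ?_).contMDiffAt
    ((chartAt HM x).open_source.mem_nhds (mem_chart_source HM x))
  simp only [Function.comp]
  rw [(extChartAt IM x).left_inv (by simpa using hy)]

end ParametricIntegral

section CompactOperators

variable {X 𝓗 : Type*} [TopologicalSpace X] [CompactSpace X]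
  [NormedAddCommGroup 𝓗] [InnerProductSpace ℂ 𝓗]

/-- The integral operator with kernel `κ`: it sends a vector `f` to the function
`x ↦ ⟪κ x, f⟫`. -/
noncomputable def innerOperator (κ : C(X, 𝓗)) : 𝓗 →L[ℂ] C(X, ℂ) :=
  LinearMap.mkContinuous
    { toFun := fun f => ⟨fun x => inner ℂ (κ x) f, by fun_prop⟩
      map_add' := fun f g => by ext x; simp
      map_smul' := fun c f => by ext x; simp }
    ‖κ‖ fun f => by
      rw [ContinuousMap.norm_le _ (by positivity)]
      intro x
      exact (norm_inner_le_norm _ _).trans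
        (mul_le_mul_of_nonneg_right (κ.norm_coe_le_norm x) (norm_nonneg _))

@[simp]
theorem innerOperator_apply (κ : C(X, 𝓗)) (f : 𝓗) (x : X) :
    innerOperator κ f x = inner ℂ (κ x) f := rfl

theorem equicontinuous_innerOperator (κ : C(X, 𝓗)) :
    Equicontinuous fun (f : Metric.closedBall (0 : 𝓗) 1) x => innerOperator κ f x := by
  intro x
  rw [Metric.equicontinuousAt_iff_right]
  intro ε hε
  filter_upwards [Metric.continuousAt_iff'.1 κ.continuous.continuousAt ε hε] with y hy f
  have hf : ‖(f : 𝓗)‖ ≤ 1 := mem_closedBall_zero_iff.1 f.2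
  calc dist (innerOperator κ f x) (innerOperator κ f y)
      = ‖inner ℂ (κ y - κ x) (f : 𝓗)‖ := by
        rw [dist_comm, dist_eq_norm, innerOperator_apply, innerOperator_apply, ← inner_sub_left]
    _ ≤ ‖κ y - κ x‖ * ‖(f : 𝓗)‖ := norm_inner_le_norm _ _
    _ ≤ dist (κ y) (κ x) := by
        rw [dist_eq_norm]
        exact mul_le_of_le_one_right (norm_nonneg _) hf
    _ < ε := hy

theorem isCompactOperator_innerOperator (κ : C(X, 𝓗)) : IsCompactOperator (innerOperator κ) := by
  rw [← ContinuousLinearMap.coe_coe,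
    isCompactOperator_iff_isCompact_closure_image_closedBall _ zero_lt_one]
  let e : C(X, ℂ) ≃ₜ BoundedContinuousFunction X ℂ :=
    (ContinuousMap.isometryEquivBoundedOfCompact X ℂ).toHomeomorph
  rw [← e.isCompact_image, e.image_closure]
  refine BoundedContinuousFunction.arzela_ascoli (Metric.closedBall 0 ‖innerOperator κ‖)
    (isCompact_closedBall _ _) _ ?_ ?_
  · rintro _ x ⟨_, ⟨f, hf, rfl⟩, rfl⟩
    rw [mem_closedBall_zero_iff] at hf ⊢
    calc ‖innerOperator κ f x‖ ≤ ‖innerOperator κ f‖ := ContinuousMap.norm_coe_le_norm _ _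
      _ ≤ ‖innerOperator κ‖ * ‖f‖ := ContinuousLinearMap.le_opNorm _ _
      _ ≤ ‖innerOperator κ‖ := mul_le_of_le_one_right (norm_nonneg _) hf
  · have mem_image : ∀ F : e '' (innerOperator κ '' Metric.closedBall 0 1),
        ∃ f : Metric.closedBall (0 : 𝓗) 1, e (innerOperator κ f) = F := by
      rintro ⟨_, _, ⟨f, hf, rfl⟩, rfl⟩
      exact ⟨⟨f, hf⟩, rfl⟩
    choose f hf using mem_image
    have coe_eq : (fun (F : e '' (innerOperator κ '' Metric.closedBall 0 1)) x => F.1 x) =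
        (fun (f : Metric.closedBall (0 : 𝓗) 1) x => innerOperator κ f x) ∘ f := by
      funext F x
      rw [← hf F]
      rfl
    exact coe_eq ▸ (equicontinuous_innerOperator κ).comp f

variable [CompleteSpace 𝓗] {C D : 𝓗 →L[ℂ] 𝓗}

/-- By the spectral theorem `D` vanishes on the range of `C C*`, and hence on that of `C`. -/
theorem mul_eq_zero_of_forall_eigenvector (hC : IsCompactOperator C)
    (hD : ∀ c : ℂ, c ≠ 0 → ∀ f, (C * star C) f = c • f → D f = 0) : D * C = 0 := by
  have hcompact : IsCompactOperator (C * star C) := hC.comp_clm _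
  have hsymm : (C * star C).IsSymmetric := fun x y => by
    simp [ContinuousLinearMap.star_eq_adjoint, ← ContinuousLinearMap.adjoint_inner_right]
  have hdense : (⨆ c, Module.End.eigenspace
      ((C * star C : 𝓗 →L[ℂ] 𝓗) : Module.End ℂ 𝓗) c).topologicalClosure = ⊤ := by
    rw [Submodule.topologicalClosure_eq_top_iff]
    exact ContinuousLinearMap.orthogonalComplement_iSup_eigenspaces_eq_bot hcompact hsymm
  have hle : (⨆ c, Module.End.eigenspace ((C * star C : 𝓗 →L[ℂ] 𝓗) : Module.End ℂ 𝓗) c) ≤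
      LinearMap.ker (D * (C * star C) : 𝓗 →L[ℂ] 𝓗).toLinearMap := by
    refine iSup_le fun c f hf => ?_
    have hf : (C * star C) f = c • f := Module.End.mem_eigenspace_iff.1 hf
    change D ((C * star C) f) = 0
    rw [hf, map_smul]
    by_cases hc : c = 0
    · rw [hc, zero_smul]
    · rw [hD c hc f hf, smul_zero]
  have hzero : D * (C * star C) = 0 := by
    ext f
    exact Submodule.topologicalClosure_minimal _ hle (ContinuousLinearMap.isClosed_ker _)
      (hdense ▸ Submodule.mem_top : f ∈ _)
  rw [← CStarRing.mul_star_self_eq_zero_iff, star_mul, ← mul_assoc, mul_assoc D, hzero, zero_mul]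

end CompactOperators

section UnitaryRepresentation

variable {G 𝓗 : Type*} [Group G] [NormedAddCommGroup 𝓗] [InnerProductSpace ℂ 𝓗]
  (U : G →* (𝓗 ≃ₗᵢ[ℂ] 𝓗))

theorem inner_unitary_right (g : G) (u f : 𝓗) : inner ℂ u (U g f) = inner ℂ (U g⁻¹ u) f := by
  rw [map_inv]
  exact ((U g).symm.inner_map_eq_flip u f).symm

theorem adjoint_apply_unitary [CompleteSpace 𝓗] {C : 𝓗 →L[ℂ] 𝓗}
    (hC : ∀ g f, C (U g f) = U g (C f)) (g : G) (f : 𝓗) :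
    (star C) (U g f) = U g ((star C) f) := by
  refine ext_inner_left ℂ fun u => ?_
  simp only [ContinuousLinearMap.star_eq_adjoint, ContinuousLinearMap.adjoint_inner_right,
    inner_unitary_right, hC]

end UnitaryRepresentation

section RegularRepresentation

variable {G : Type*} [TopologicalSpace G] [Group G] [IsTopologicalGroup G]
  [MeasurableSpace G] [BorelSpace G] (μ : Measure G)

section Convolution

variable [CompactSpace G] [IsFiniteMeasure μ]

/-- The left translates of `k`, as a continuous family in `L²(G)`. -/
noncomputable def translates (k : C(G, ℂ)) : C(G, Lp ℂ 2 μ) :=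
  ContinuousMap.comp ⟨ContinuousMap.toLp 2 μ ℂ, map_continuous _⟩
    (ContinuousMap.curry ⟨fun q : G × G => k (q.1⁻¹ * q.2), by fun_prop⟩)

/-- The operator `f ↦ (x ↦ ∫ conj (k (x⁻¹ y)) f y dy)` on `L²(G)`. -/
noncomputable def convolutionOperator (k : C(G, ℂ)) : Lp ℂ 2 μ →L[ℂ] Lp ℂ 2 μ :=
  ContinuousMap.toLp 2 μ ℂ ∘L innerOperator (translates μ k)

theorem isCompactOperator_convolutionOperator (k : C(G, ℂ)) :
    IsCompactOperator (convolutionOperator μ k) :=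
  (isCompactOperator_innerOperator (translates μ k)).clm_comp
    (ContinuousMap.toLp 2 μ ℂ : C(G, ℂ) →L[ℂ] Lp ℂ 2 μ)

end Convolution

variable [μ.IsMulLeftInvariant]

/-- The left regular representation `(g · f)(x) = f (g⁻¹ x)` of `G` on `L²(G)`. -/
noncomputable def leftRegular : G →* (Lp ℂ 2 μ ≃ₗᵢ[ℂ] Lp ℂ 2 μ) where
  toFun g :=
    { DistribMulAction.toLinearEquiv ℂ (Lp ℂ 2 μ) (DomMulAct.mk g⁻¹) with
      norm_map' := DomMulAct.norm_smul_Lp _ }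
  map_one' := by
    ext1 f
    exact (congrArg (· • f) (by simp)).trans (one_smul (Gᵈᵐᵃ) f)
  map_mul' g h := by
    ext1 f
    exact (congrArg (· • f) (by simp)).trans (mul_smul (DomMulAct.mk g⁻¹) (DomMulAct.mk h⁻¹) f)

variable [CompactSpace G] [IsFiniteMeasure μ]

theorem leftRegular_toLp (g : G) (F : C(G, ℂ)) :
    leftRegular μ g (ContinuousMap.toLp 2 μ ℂ F) =
      ContinuousMap.toLp 2 μ ℂ (F.comp ⟨fun x => g⁻¹ * x, by fun_prop⟩) := by
  rfl

theorem translates_apply (k : C(G, ℂ)) (x : G) :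
    translates μ k x = leftRegular μ x (ContinuousMap.toLp 2 μ ℂ k) := rfl

theorem convolutionOperator_leftRegular (k : C(G, ℂ)) (g : G) (f : Lp ℂ 2 μ) :
    convolutionOperator μ k (leftRegular μ g f) = leftRegular μ g (convolutionOperator μ k f) := by
  have comp_eq : innerOperator (translates μ k) (leftRegular μ g f) =
      (innerOperator (translates μ k) f).comp ⟨fun x => g⁻¹ * x, by fun_prop⟩ := by
    ext x
    simp only [innerOperator_apply, translates_apply, inner_unitary_right, ContinuousMap.comp_apply,
      ContinuousMap.coe_mk, map_mul]
    rfl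
  exact congrArg (ContinuousMap.toLp 2 μ ℂ) comp_eq

theorem apply_inv_mul_eq_of_leftRegular_convolutionOperator [μ.IsOpenPosMeasure] {k : C(G, ℂ)}
    {g : G} (hg : ∀ f, leftRegular μ g (convolutionOperator μ k f) = convolutionOperator μ k f)
    (x : G) : k (g⁻¹ * x) = k x := by
  have translates_eq : translates μ k g = translates μ k 1 := by
    refine ext_inner_right ℂ fun f => ?_
    have h := DFunLike.congr_fun (ContinuousMap.toLp_injective (p := 2) (𝕜 := ℂ) μ
      ((leftRegular_toLp μ g (innerOperator (translates μ k) f)).symm.trans (hg f))) g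
    simpa using h.symm
  have h := DFunLike.congr_fun (ContinuousMap.toLp_injective (p := 2) (𝕜 := ℂ) μ translates_eq) x
  simpa using h

end RegularRepresentation

section SmoothSubrep

variable {EG HG G 𝓗 : Type*} [NormedAddCommGroup EG] [NormedSpace ℝ EG] [TopologicalSpace HG]
  (IG : ModelWithCorners ℝ EG HG) [TopologicalSpace G] [ChartedSpace HG G] [Group G]
  [NormedAddCommGroup 𝓗] [InnerProductSpace ℂ 𝓗] (U : G →* (𝓗 ≃ₗᵢ[ℂ] 𝓗))

/-- A finite-dimensional subrepresentation of `U` with smooth matrix coefficients. -/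
structure IsSmoothSubrep (W : Submodule ℂ 𝓗) : Prop where
  finiteDimensional : FiniteDimensional ℂ W
  invariant : ∀ g, ∀ f ∈ W, U g f ∈ W
  smooth : ∀ w, ∀ f ∈ W, ContMDiff IG 𝓘(ℝ, ℂ) ∞ fun g => inner ℂ w (U g f)

/-- The smooth subrepresentations of `U` separate the points of `G`. -/
def SmoothSubrepsSeparate : Prop :=
  ∀ g ≠ 1, ∃ W, IsSmoothSubrep IG U W ∧ ∃ f ∈ W, U g f ≠ f

variable {IG U}

theorem IsSmoothSubrep.bot : IsSmoothSubrep IG U ⊥ where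
  finiteDimensional := inferInstance
  invariant g f hf := by
    rw [Submodule.mem_bot] at hf ⊢
    rw [hf, map_zero]
  smooth w f hf := by
    rw [Submodule.mem_bot] at hf
    simpa only [hf, map_zero, inner_zero_right] using contMDiff_const

theorem IsSmoothSubrep.sup {W W' : Submodule ℂ 𝓗} (hW : IsSmoothSubrep IG U W)
    (hW' : IsSmoothSubrep IG U W') : IsSmoothSubrep IG U (W ⊔ W') where
  finiteDimensional := by
    have := hW.finiteDimensional
    have := hW'.finiteDimensional
    infer_instance
  invariant g f hf := by
    obtain ⟨a, ha, b, hb, rfl⟩ := Submodule.mem_sup.1 hf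
    rw [map_add]
    exact Submodule.add_mem_sup (hW.invariant g a ha) (hW'.invariant g b hb)
  smooth w f hf := by
    obtain ⟨a, ha, b, hb, rfl⟩ := Submodule.mem_sup.1 hf
    simp only [map_add, inner_add_right]
    exact (hW.smooth w a ha).add (hW'.smooth w b hb)

end SmoothSubrep

section SmoothRegularRepresentation

variable {EG HG : Type*} [NormedAddCommGroup EG] [NormedSpace ℝ EG] [FiniteDimensional ℝ EG]
  [TopologicalSpace HG] {IG : ModelWithCorners ℝ EG HG} [IG.Boundaryless]
  {G : Type*} [TopologicalSpace G] [ChartedSpace HG G] [Group G] [LieGroup IG ∞ G]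
  [IsTopologicalGroup G] [CompactSpace G] [MeasurableSpace G] [BorelSpace G]
  {μ : Measure G} [IsFiniteMeasure μ] [μ.IsMulLeftInvariant] {k : C(G, ℂ)}

theorem contMDiff_inner_leftRegular_toLp (hk : ContMDiff IG 𝓘(ℝ, ℂ) ∞ k) (w : Lp ℂ 2 μ) :
    ContMDiff IG 𝓘(ℝ, ℂ) ∞ fun g => inner ℂ w (leftRegular μ g (ContinuousMap.toLp 2 μ ℂ k)) := by
  have inner_eq (g : G) : inner ℂ w (leftRegular μ g (ContinuousMap.toLp 2 μ ℂ k)) =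
      ∫ y, (starRingEnd ℂ) (w y) • k (g⁻¹ * y) ∂μ := by
    rw [leftRegular_toLp, L2.inner_def]
    refine integral_congr_ae ?_
    filter_upwards [ContinuousMap.coeFn_toLp (p := 2) μ (𝕜 := ℂ)
      (k.comp ⟨fun y => g⁻¹ * y, by fun_prop⟩)] with y hy
    rw [hy, RCLike.inner_apply', smul_eq_mul]
    rfl
  have hw : Integrable (fun y => (starRingEnd ℂ) (w y)) μ :=
    Complex.conjCLE.toContinuousLinearMap.integrable_comp
      ((Lp.memLp w).integrable one_le_two)
  simp only [inner_eq]
  exact contMDiff_integral_smul (IY := IG) (Φ := fun g y => k (g⁻¹ * y)) hw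
    (hk.comp (contMDiff_fst.inv.mul contMDiff_snd))

theorem contMDiff_innerOperator_translates (hk : ContMDiff IG 𝓘(ℝ, ℂ) ∞ k) (u : Lp ℂ 2 μ) :
    ContMDiff IG 𝓘(ℝ, ℂ) ∞ (innerOperator (translates μ k) u) :=
  (Complex.conjCLE.contDiff.contMDiff.comp (contMDiff_inner_leftRegular_toLp hk u)).congr
    fun x => (inner_conj_symm (translates μ k x) u).symm

theorem isSmoothSubrep_eigenspace (hk : ContMDiff IG 𝓘(ℝ, ℂ) ∞ k) {c : ℂ} (hc : c ≠ 0) :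
    IsSmoothSubrep IG (leftRegular μ) (Module.End.eigenspace
      ((convolutionOperator μ k * star (convolutionOperator μ k) : Lp ℂ 2 μ →L[ℂ] Lp ℂ 2 μ) :
        Module.End ℂ (Lp ℂ 2 μ)) c) where
  finiteDimensional := ContinuousLinearMap.finite_dimensional_eigenspace
    ((isCompactOperator_convolutionOperator μ k).comp_clm _) c hc
  invariant g f hf := by
    rw [Module.End.mem_eigenspace_iff, ContinuousLinearMap.coe_coe,
      mul_apply_eq_comp] at hf ⊢
    rw [adjoint_apply_unitary _ (convolutionOperator_leftRegular μ k),
      convolutionOperator_leftRegular, hf, map_smul]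
  smooth w f hf := by
    rw [Module.End.mem_eigenspace_iff, ContinuousLinearMap.coe_coe,
      mul_apply_eq_comp] at hf
    have hf' : f = c⁻¹ • ContinuousMap.toLp 2 μ ℂ
        (innerOperator (translates μ k) (star (convolutionOperator μ k) f)) :=
      (inv_smul_smul₀ hc f).symm.trans (congrArg _ hf.symm)
    rw [hf']
    simp only [map_smul, inner_smul_right]
    exact (ContinuousLinearMap.mul ℝ ℂ c⁻¹).contDiff.contMDiff.comp
      (contMDiff_inner_leftRegular_toLp (contMDiff_innerOperator_translates hk _) w)

variable (μ) in
theorem smoothSubrepsSeparate_leftRegular [T2Space G] [μ.IsOpenPosMeasure] :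
    SmoothSubrepsSeparate IG (leftRegular μ) := by
  intro g hg
  by_contra! hfix
  obtain ⟨ψ, hψ0, hψ1, -⟩ := exists_contMDiffMap_zero_one_of_isClosed (n := ⊤) IG
    (isClosed_singleton (x := g)) (isClosed_singleton (x := (1 : G))) (by simpa using hg)
  have hk : ContMDiff IG 𝓘(ℝ, ℂ) ∞ fun x => (ψ x : ℂ) :=
    Complex.ofRealCLM.contDiff.contMDiff.comp ψ.contMDiff
  let k : C(G, ℂ) := ⟨fun x => (ψ x : ℂ), hk.continuous⟩
  let D : Lp ℂ 2 μ →L[ℂ] Lp ℂ 2 μ := (leftRegular μ g : Lp ℂ 2 μ →L[ℂ] Lp ℂ 2 μ) - 1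
  have hD : D * convolutionOperator μ k = 0 :=
    mul_eq_zero_of_forall_eigenvector (isCompactOperator_convolutionOperator μ k)
      fun c hc f hf => sub_eq_zero.2 (hfix _ (isSmoothSubrep_eigenspace (k := k) hk hc) f
        (Module.End.mem_eigenspace_iff.2 hf))
  have hψ : k (g⁻¹ * g) = k g := apply_inv_mul_eq_of_leftRegular_convolutionOperator μ
    (fun f => sub_eq_zero.1 (DFunLike.congr_fun hD f)) g
  have hψ : ψ 1 = ψ g := by simpa [k] using hψ
  rw [hψ0 rfl, hψ1 rfl] at hψ
  exact one_ne_zero hψ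

end SmoothRegularRepresentation

section IntegralCurves

variable {E H M : Type*} [NormedAddCommGroup E] [NormedSpace ℝ E] [TopologicalSpace H]
  {I : ModelWithCorners ℝ E H} [TopologicalSpace M] [ChartedSpace H M]
  {F : Type*} [NormedAddCommGroup F] [NormedSpace ℝ F] {c : ℝ → M} {s : ℝ}

theorem hasDerivAt_comp_of_mfderiv_eq_zero {φ : M → F} (hφ : MDifferentiableAt I 𝓘(ℝ, F) φ (c s))
    {X : TangentSpace I (c s)}
    (hc : HasMFDerivAt 𝓘(ℝ, ℝ) I c s ((1 : ℝ →L[ℝ] ℝ).smulRight X))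
    (hX : mfderiv I 𝓘(ℝ, F) φ (c s) X = 0) : HasDerivAt (φ ∘ c) 0 s := by
  obtain ⟨B, hB, hB1⟩ : ∃ B : ℝ →L[ℝ] F, HasFDerivAt (φ ∘ c) B s ∧ B 1 = 0 := by
    refine ⟨(mfderiv I 𝓘(ℝ, F) φ (c s) : E →L[ℝ] F).comp
      ((1 : ℝ →L[ℝ] ℝ).smulRight (X : E)),
      hasMFDerivAt_iff_hasFDerivAt.1 (hφ.hasMFDerivAt.comp s hc), ?_⟩
    have comp_apply_one (A : E →L[ℝ] F) (Y : E) :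
        (A.comp ((1 : ℝ →L[ℝ] ℝ).smulRight Y)) 1 = A Y := by
      simp
    exact (comp_apply_one _ _).trans hX
  exact hB1 ▸ hB.hasDerivAt

theorem eq_zero_of_eventuallyEq_const {X : TangentSpace I (c s)}
    (hc : HasMFDerivAt 𝓘(ℝ, ℝ) I c s ((1 : ℝ →L[ℝ] ℝ).smulRight X)) {x : M}
    (hconst : c =ᶠ[𝓝 s] fun _ => x) : X = 0 := by
  have hX := congrArg (fun A : ℝ →L[ℝ] E => A 1)
    (hasMFDerivAt_unique hc ((hasMFDerivAt_const x s).congr_of_eventuallyEq hconst))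
  exact (one_smul ℝ (X : E)).symm.trans hX

end IntegralCurves

section InvariantVectorFields

variable {E H G : Type*} [NormedAddCommGroup E] [NormedSpace ℝ E] [TopologicalSpace H]
  {I : ModelWithCorners ℝ E H} [TopologicalSpace G] [ChartedSpace H G] [Group G]

theorem mulInvariantVectorField_at_one (v : GroupLieAlgebra I G) :
    mulInvariantVectorField v (1 : G) = (v : E) := by
  have hid : HasMFDerivAt I I (fun x : G => 1 * x) 1 (ContinuousLinearMap.id ℝ E) :=
    (hasMFDerivAt_id (1 : G)).congr_of_eventuallyEq (Filter.Eventually.of_forall one_mul)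
  exact congrArg (fun A : E →L[ℝ] E => A v) hid.mfderiv

variable [LieGroup I ∞ G] {F : Type*} [NormedAddCommGroup F] [NormedSpace ℝ F]

theorem mfderiv_comp_mul_left_one {φ : G → F} {a : G} (hφ : MDifferentiableAt I 𝓘(ℝ, F) φ a)
    (v : GroupLieAlgebra I G) :
    mfderiv I 𝓘(ℝ, F) (fun x => φ (a * x)) 1 v =
      mfderiv I 𝓘(ℝ, F) φ a (mulInvariantVectorField v a) := by
  have hmul : HasMFDerivAt I I (a * ·) 1 (mfderiv I I (a * ·) (1 : G)) :=
    ((contMDiff_mul_left (n := ∞)).mdifferentiableAt (by simp)).hasMFDerivAt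
  have hφ' : HasMFDerivAt I 𝓘(ℝ, F) φ (a * 1)
      (mfderiv I 𝓘(ℝ, F) φ a : E →L[ℝ] F) := by
    rw [mul_one]
    exact hφ.hasMFDerivAt
  exact congrArg (fun A : E →L[ℝ] F => A v) (hφ'.comp 1 hmul).mfderiv

end InvariantVectorFields

section Infinitesimal

variable {EG HG G 𝓗 : Type*} [NormedAddCommGroup EG] [NormedSpace ℝ EG] [TopologicalSpace HG]
  (IG : ModelWithCorners ℝ EG HG) [TopologicalSpace G] [ChartedSpace HG G] [Group G]
  [NormedAddCommGroup 𝓗] [InnerProductSpace ℂ 𝓗] (U : G →* (𝓗 ≃ₗᵢ[ℂ] 𝓗))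

/-- The tangent vectors at the identity along which all matrix coefficients of `W` have
vanishing derivative. -/
noncomputable def infinitesimalKernel (W : Submodule ℂ 𝓗) :
    Submodule ℝ (GroupLieAlgebra IG G) where
  carrier := {v | ∀ w, ∀ f ∈ W, mfderiv IG 𝓘(ℝ, ℂ) (fun g => inner ℂ w (U g f)) (1 : G) v = 0}
  add_mem' {a b} ha hb w f hf := by rw [map_add, ha w f hf, hb w f hf, add_zero]
  zero_mem' _ _ _ := map_zero _
  smul_mem' c a ha w f hf := by rw [map_smul, ha w f hf, smul_zero]

variable {IG U}

theorem infinitesimalKernel_anti {W W' : Submodule ℂ 𝓗} (h : W ≤ W') :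
    infinitesimalKernel IG U W' ≤ infinitesimalKernel IG U W :=
  fun _ hv w f hf => hv w f (h hf)

variable [LieGroup IG ∞ G]

theorem IsSmoothSubrep.mfderiv_coefficient_mulInvariantVectorField {W : Submodule ℂ 𝓗}
    (hW : IsSmoothSubrep IG U W) {v : GroupLieAlgebra IG G} (hv : v ∈ infinitesimalKernel IG U W)
    (w : 𝓗) {f : 𝓗} (hf : f ∈ W) (a : G) :
    mfderiv IG 𝓘(ℝ, ℂ) (fun g => inner ℂ w (U g f)) a (mulInvariantVectorField v a) = 0 := by
  have translate : (fun x => inner ℂ w (U (a * x) f)) = fun x => inner ℂ (U a⁻¹ w) (U x f) := by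
    funext x
    rw [← inner_unitary_right, map_mul]
    rfl
  have hv := hv (U a⁻¹ w) f hf
  rw [← translate] at hv
  exact (mfderiv_comp_mul_left_one
    ((hW.smooth w f hf).mdifferentiableAt (by simp)) v).symm.trans hv

/-- The integral curve of `v` through `1` is not moved by any smooth subrepresentation. -/
theorem eq_zero_of_forall_mem_infinitesimalKernel [CompleteSpace EG] [IG.Boundaryless]
    [T2Space G] (hsep : SmoothSubrepsSeparate IG U) {v : GroupLieAlgebra IG G}
    (hv : ∀ W, IsSmoothSubrep IG U W → v ∈ infinitesimalKernel IG U W) : v = 0 := by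
  have : LieGroup IG (minSmoothness ℝ 3) G :=
    LieGroup.of_le (n := ∞) (by rw [minSmoothness_of_isRCLikeNormedField]; exact ENat.LEInfty.out)
  have : IsManifold IG 1 G := IsManifold.of_le (n := ∞) (by simp)
  obtain ⟨c, hc0, hc⟩ := exists_isMIntegralCurveAt_of_contMDiffAt_boundaryless (I := IG) 0
    (v := mulInvariantVectorField v) (x₀ := (1 : G))
    ((contMDiffAt_mulInvariantVectorField v).of_le (by simp))
  obtain ⟨ε, hε, hball⟩ := Metric.eventually_nhds_iff_ball.1 hc
  have hconst : ∀ t ∈ Metric.ball (0 : ℝ) ε, c t = 1 := by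
    intro t ht
    by_contra hne
    obtain ⟨W, hW, f, hf, hfne⟩ := hsep _ hne
    refine hfne (ext_inner_left ℂ fun w => ?_)
    have hderiv : ∀ s ∈ Metric.ball (0 : ℝ) ε,
        HasDerivAt ((fun g => inner ℂ w (U g f)) ∘ c) 0 s := fun s hs =>
      hasDerivAt_comp_of_mfderiv_eq_zero ((hW.smooth w f hf).mdifferentiableAt (by simp))
        (hball s hs) (hW.mfderiv_coefficient_mulInvariantVectorField (hv W hW) w hf (c s))
    have hcoeff := Metric.isOpen_ball.is_const_of_deriv_eq_zero
      (convex_ball (0 : ℝ) ε).isPreconnected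
      (fun s hs => (hderiv s hs).differentiableAt.differentiableWithinAt)
      (fun s hs => (hderiv s hs).deriv) ht (Metric.mem_ball_self hε)
    simpa only [Function.comp, hc0, map_one, LinearIsometryEquiv.coe_one, id] using hcoeff
  have hX := eq_zero_of_eventuallyEq_const (hball 0 (Metric.mem_ball_self hε))
    (Filter.eventually_of_mem (Metric.ball_mem_nhds 0 hε) hconst)
  rw [hc0] at hX
  exact (mulInvariantVectorField_at_one v).symm.trans hX

theorem exists_isSmoothSubrep_infinitesimalKernel_eq_bot [FiniteDimensional ℝ EG]
    [IG.Boundaryless] [T2Space G] (hsep : SmoothSubrepsSeparate IG U) :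
    ∃ W, IsSmoothSubrep IG U W ∧ infinitesimalKernel IG U W = ⊥ := by
  have : CompleteSpace EG := FiniteDimensional.complete ℝ EG
  have : FiniteDimensional ℝ (GroupLieAlgebra IG G) := inferInstanceAs (FiniteDimensional ℝ EG)
  have : Nonempty {W // IsSmoothSubrep IG U W} := ⟨⟨⊥, IsSmoothSubrep.bot⟩⟩
  let dim (W : {W // IsSmoothSubrep IG U W}) : ℕ :=
    Module.finrank ℝ (infinitesimalKernel IG U W.1)
  obtain ⟨W, hmin⟩ : ∃ W, ∀ W', dim W ≤ dim W' := ⟨_, fun W' => Function.argmin_le dim W'⟩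
  refine ⟨W.1, W.2, (Submodule.eq_bot_iff _).2 fun v hv => ?_⟩
  refine eq_zero_of_forall_mem_infinitesimalKernel hsep fun W' hW' => ?_
  have heq : infinitesimalKernel IG U (W.1 ⊔ W') = infinitesimalKernel IG U W.1 :=
    Submodule.eq_of_le_of_finrank_le (infinitesimalKernel_anti le_sup_left)
      (hmin ⟨_, W.2.sup hW'⟩)
  exact infinitesimalKernel_anti le_sup_right (heq ▸ hv)

end Infinitesimal

section LeftInverse

variable {E F : Type*} [NormedAddCommGroup E] [NormedSpace ℝ E] [FiniteDimensional ℝ E]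
  [NormedAddCommGroup F] [NormedSpace ℝ F] [FiniteDimensional ℝ F]

theorem exists_contDiffAt_leftInverse {f : E → F} {x : E} (hf : ContDiffAt ℝ ∞ f x)
    (hinj : Function.Injective (fderiv ℝ f x)) :
    ∃ r : F → E, ContDiffAt ℝ ∞ r (f x) ∧ ∀ᶠ y in 𝓝 x, r (f y) = y := by
  have : CompleteSpace E := FiniteDimensional.complete ℝ E
  obtain ⟨L, hL⟩ := LinearMap.exists_leftInverse_of_injective (fderiv ℝ f x).toLinearMap
    (LinearMap.ker_eq_bot.2 hinj)
  let Lc : F →L[ℝ] E := LinearMap.toContinuousLinearMap L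
  have hLf : ContDiffAt ℝ ∞ (Lc ∘ f) x := Lc.contDiff.contDiffAt.comp _ hf
  have hLf' : HasFDerivAt (Lc ∘ f) (ContinuousLinearEquiv.refl ℝ E : E →L[ℝ] E) x := by
    convert! Lc.hasFDerivAt.comp x (hf.differentiableAt (by simp)).hasFDerivAt using 1
    ext v
    exact (LinearMap.congr_fun hL v).symm
  have hn : (∞ : ℕ∞ω) ≠ 0 := by simp
  exact ⟨hLf.localInverse hLf' hn ∘ Lc,
    (hLf.to_localInverse hLf' hn).comp (f x) Lc.contDiff.contDiffAt,
    (hLf.hasStrictFDerivAt' hLf' hn).eventually_left_inverse⟩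

variable {HM M : Type*} [TopologicalSpace HM] {IM : ModelWithCorners ℝ E HM} [IM.Boundaryless]
  [TopologicalSpace M] [ChartedSpace HM M] [IsManifold IM ∞ M]

theorem exists_contMDiffAt_leftInverse {f : M → F} {x : M} (hf : ContMDiff IM 𝓘(ℝ, F) ∞ f)
    (hinj : Function.Injective (mfderiv IM 𝓘(ℝ, F) f x)) :
    ∃ r : F → M, ContMDiffAt 𝓘(ℝ, F) IM ∞ r (f x) ∧ ∀ᶠ y in 𝓝 x, r (f y) = y := by
  set e := extChartAt IM x
  have e_symm : e.symm (e x) = x := extChartAt_to_inv x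
  have htarget : e.target ∈ 𝓝 (e x) := extChartAt_target_mem_nhds x
  have hfe : ContDiffAt ℝ ∞ (f ∘ e.symm) (e x) := contMDiffAt_iff_contDiffAt.1
    ((hf.comp_contMDiffOn (contMDiffOn_extChartAt_symm x)).contMDiffAt htarget)
  have hderiv : mfderiv IM 𝓘(ℝ, F) f x = fderiv ℝ (f ∘ e.symm) (e x) := by
    rw [(hf.mdifferentiableAt (by simp)).mfderiv, IM.range_eq_univ, fderivWithin_univ]
    rfl
  rw [hderiv] at hinj
  obtain ⟨r, hr, hrf⟩ := exists_contDiffAt_leftInverse hfe hinj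
  have r_apply : r (f x) = e x := by simpa [e_symm] using hrf.self_of_nhds
  rw [Function.comp_apply, e_symm] at hr
  refine ⟨e.symm ∘ r, ?_, ?_⟩
  · refine ContMDiffAt.comp (x := f x) (g := e.symm) ?_ (contMDiffAt_iff_contDiffAt.2 hr)
    rw [r_apply]
    exact (contMDiffOn_extChartAt_symm x).contMDiffAt htarget
  · filter_upwards [(continuousAt_extChartAt (I := IM) x).eventually hrf,
      extChartAt_source_mem_nhds (I := IM) x] with y hy hys
    have e_symm_y : e.symm (e y) = y := e.left_inv hys
    rw [Function.comp_apply, e_symm_y] at hy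
    rw [Function.comp_apply, hy, e_symm_y]

end LeftInverse

section OperatorValued

variable {E HM M : Type*} [NormedAddCommGroup E] [NormedSpace ℝ E]
  [TopologicalSpace HM] {IM : ModelWithCorners ℝ E HM} [TopologicalSpace M] [ChartedSpace HM M]
  {V : Type*} [NormedAddCommGroup V] [InnerProductSpace ℂ V] {ρ : M → V →L[ℂ] V}

theorem sum_inner_smul_smulRight {ι : Type*} [Fintype ι] (b : OrthonormalBasis ι ℂ V)
    (A : V →L[ℂ] V) :
    ∑ i, ∑ j, (inner ℂ (b i) (A (b j)) : ℂ) • (innerSL ℂ (b j)).smulRight (b i) = A := by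
  ext v
  simp only [sum_apply, smul_apply, ContinuousLinearMap.smulRight_apply, innerSL_apply_apply]
  calc ∑ i, ∑ j, inner ℂ (b i) (A (b j)) • inner ℂ (b j) v • b i
      = ∑ i, inner ℂ (b i) (A (∑ j, inner ℂ (b j) v • b j)) • b i := by
        simp only [map_sum, map_smul, inner_sum, inner_smul_right, Finset.sum_smul, smul_smul,
          mul_comm]
    _ = A v := by rw [b.sum_repr' v, b.sum_repr']

theorem contMDiff_of_coefficients [FiniteDimensional ℂ V]
    (h : ∀ v w : V, ContMDiff IM 𝓘(ℝ, ℂ) ∞ fun x => inner ℂ w (ρ x v)) :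
    ContMDiff IM 𝓘(ℝ, V →L[ℂ] V) ∞ ρ := by
  let b := stdOrthonormalBasis ℂ V
  rw [show ρ = _ from funext fun x => (sum_inner_smul_smulRight b (ρ x)).symm]
  refine contMDiff_finsetSum fun i _ => contMDiff_finsetSum fun j _ => ?_
  exact (((ContinuousLinearMap.toSpanSingleton ℂ
    ((innerSL ℂ (b j)).smulRight (b i) : V →L[ℂ] V)).restrictScalars ℝ).contDiff.contMDiff).comp
      (h _ _)

theorem mfderiv_injective_of_coefficients {x : M} (hρ : ContMDiff IM 𝓘(ℝ, V →L[ℂ] V) ∞ ρ)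
    (h : ∀ t : TangentSpace IM x, (∀ v w : V,
      mfderiv IM 𝓘(ℝ, ℂ) (fun x => inner ℂ w (ρ x v)) x t = 0) → t = 0) :
    Function.Injective (mfderiv IM 𝓘(ℝ, V →L[ℂ] V) ρ x) := by
  refine (injective_iff_map_eq_zero _).2 fun t ht => h t fun v w => ?_
  let L : (V →L[ℂ] V) →L[ℝ] ℂ :=
    ((innerSL ℂ w).comp (ContinuousLinearMap.apply ℂ V v)).restrictScalars ℝ
  have hL : HasMFDerivAt IM 𝓘(ℝ, ℂ) (fun x => inner ℂ w (ρ x v)) x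
      (L.comp (mfderiv IM 𝓘(ℝ, V →L[ℂ] V) ρ x : E →L[ℝ] (V →L[ℂ] V))) :=
    L.hasMFDerivAt.comp x (hρ.mdifferentiableAt (by simp)).hasMFDerivAt
  rw [hL.mfderiv]
  change L (mfderiv IM 𝓘(ℝ, V →L[ℂ] V) ρ x t : V →L[ℂ] V) = 0
  rw [ht]
  exact map_zero L

end OperatorValued

section ImmersiveRepresentation

variable {EG HG G V 𝓗 : Type*} [NormedAddCommGroup EG] [NormedSpace ℝ EG] [TopologicalSpace HG]
  (IG : ModelWithCorners ℝ EG HG) [TopologicalSpace G] [ChartedSpace HG G] [Group G]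
  [NormedAddCommGroup V] [InnerProductSpace ℂ V]

/-- A smooth representation that has a smooth left inverse near the identity. -/
structure IsImmersiveRep (ρ : G →* (V →L[ℂ] V)) : Prop where
  smooth : ContMDiff IG 𝓘(ℝ, V →L[ℂ] V) ∞ ρ
  exists_leftInverse : ∃ r : (V →L[ℂ] V) → G,
    ContMDiffAt 𝓘(ℝ, V →L[ℂ] V) IG ∞ r 1 ∧ ∀ᶠ g in 𝓝 1, r (ρ g) = g

variable {IG} [NormedAddCommGroup 𝓗] [InnerProductSpace ℂ 𝓗] {U : G →* (𝓗 ≃ₗᵢ[ℂ] 𝓗)}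
  {W : Submodule ℂ 𝓗}

/-- The representation of `G` on a smooth subrepresentation of `U`. -/
noncomputable def IsSmoothSubrep.hom (hW : IsSmoothSubrep IG U W) : G →* (W →L[ℂ] W) where
  toFun g := (U g : 𝓗 →L[ℂ] 𝓗).restrict (hW.invariant g)
  map_one' := ContinuousLinearMap.ext fun f =>
    Subtype.ext (congrArg (fun u : 𝓗 ≃ₗᵢ[ℂ] 𝓗 => u f) (map_one U))
  map_mul' g h := ContinuousLinearMap.ext fun f =>
    Subtype.ext (congrArg (fun u : 𝓗 ≃ₗᵢ[ℂ] 𝓗 => u f) (map_mul U g h))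

theorem IsSmoothSubrep.coe_hom_apply (hW : IsSmoothSubrep IG U W) (g : G) (f : W) :
    (hW.hom g f : 𝓗) = U g f := rfl

theorem IsSmoothSubrep.hom_eq_one_iff (hW : IsSmoothSubrep IG U W) {g : G} :
    hW.hom g = 1 ↔ ∀ f ∈ W, U g f = f := by
  simp only [ContinuousLinearMap.ext_iff, Subtype.ext_iff, Subtype.forall, hW.coe_hom_apply,
    one_apply_eq_self]

theorem exists_isSmoothSubrep_forall_mem_isCompact (hsep : SmoothSubrepsSeparate IG U) {K : Set G}
    (hK : IsCompact K) (h1 : (1 : G) ∉ K) :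
    ∃ W, IsSmoothSubrep IG U W ∧ ∀ g ∈ K, ¬ ∀ f ∈ W, U g f = f := by
  refine hK.induction_on ⟨⊥, IsSmoothSubrep.bot, fun g hg => hg.elim⟩ ?_ ?_ fun g hg => ?_
  · rintro s t hst ⟨W, hW, h⟩
    exact ⟨W, hW, fun g hg => h g (hst hg)⟩
  · rintro s t ⟨W₁, hW₁, h₁⟩ ⟨W₂, hW₂, h₂⟩
    refine ⟨W₁ ⊔ W₂, hW₁.sup hW₂, ?_⟩
    rintro g (hg | hg) hfix
    · exact h₁ g hg fun f hf => hfix f (Submodule.mem_sup_left hf)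
    · exact h₂ g hg fun f hf => hfix f (Submodule.mem_sup_right hf)
  · obtain ⟨W, hW, f, hf, hne⟩ := hsep g (ne_of_mem_of_not_mem hg h1)
    obtain ⟨w, hw⟩ : ∃ w, inner ℂ w (U g f) ≠ inner ℂ w f := by
      by_contra! hfix
      exact hne (ext_inner_left ℂ hfix)
    have hopen : IsOpen {h : G | inner ℂ w (U h f) ≠ inner ℂ w f} :=
      isOpen_ne_fun (hW.smooth w f hf).continuous continuous_const
    exact ⟨_, mem_nhdsWithin_of_mem_nhds (hopen.mem_nhds hw), W, hW,
      fun h hh hfix => hh (congrArg (inner ℂ w) (hfix f hf))⟩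

variable [FiniteDimensional ℝ EG] [IG.Boundaryless] [LieGroup IG ∞ G]

theorem IsSmoothSubrep.isImmersiveRep_hom (hW : IsSmoothSubrep IG U W)
    (hker : infinitesimalKernel IG U W = ⊥) : IsImmersiveRep IG hW.hom := by
  have := hW.finiteDimensional
  have : FiniteDimensional ℝ (W →L[ℂ] W) := Module.Finite.trans ℂ _
  have hsmooth : ContMDiff IG 𝓘(ℝ, W →L[ℂ] W) ∞ hW.hom :=
    contMDiff_of_coefficients fun v w => hW.smooth w v v.2
  refine ⟨hsmooth, ?_⟩
  rw [← map_one hW.hom]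
  refine exists_contMDiffAt_leftInverse hsmooth
    (mfderiv_injective_of_coefficients hsmooth fun t ht => ?_)
  have ht : t ∈ infinitesimalKernel IG U W := fun w f hf => by
    have project : (fun g => inner ℂ (W.orthogonalProjectionOnto w) (hW.hom g ⟨f, hf⟩)) =
        fun g => inner ℂ w (U g f) := by
      funext g
      exact W.inner_orthogonalProjectionOnto_eq_of_mem_right ⟨_, hW.invariant g f hf⟩ w
    have ht := ht ⟨f, hf⟩ (W.orthogonalProjectionOnto w)
    rwa [project] at ht
  rwa [hker, Submodule.mem_bot] at ht

variable [T2Space G] [CompactSpace G]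

theorem exists_isSmoothSubrep_faithful (hsep : SmoothSubrepsSeparate IG U) :
    ∃ W, ∃ hW : IsSmoothSubrep IG U W, IsImmersiveRep IG hW.hom ∧
      Function.Injective hW.hom := by
  obtain ⟨W, hW, hker⟩ := exists_isSmoothSubrep_infinitesimalKernel_eq_bot hsep
  obtain ⟨r, -, hr⟩ := (hW.isImmersiveRep_hom hker).exists_leftInverse
  obtain ⟨N, hrN, hN, h1N⟩ := eventually_nhds_iff.1 hr
  obtain ⟨W', hW', hfix⟩ := exists_isSmoothSubrep_forall_mem_isCompact hsep
    hN.isClosed_compl.isCompact (not_not_intro h1N)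
  refine ⟨W ⊔ W', hW.sup hW', (hW.sup hW').isImmersiveRep_hom
    (le_bot_iff.1 ((infinitesimalKernel_anti le_sup_left).trans hker.le)),
    (injective_iff_map_eq_one _).2 fun g hg => ?_⟩
  rw [IsSmoothSubrep.hom_eq_one_iff] at hg
  have hgN : g ∈ N := not_not.1 fun hgN =>
    hfix g hgN fun f hf => hg f (Submodule.mem_sup_right hf)
  have hWg : hW.hom g = hW.hom 1 := by
    rw [map_one, hW.hom_eq_one_iff]
    exact fun f hf => hg f (Submodule.mem_sup_left hf)
  rw [← hrN g hgN, hWg, hrN 1 h1N]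

end ImmersiveRepresentation

universe u

theorem exists_faithful_unitary_rep {EG HG : Type*} {G : Type u}
    [NormedAddCommGroup EG] [NormedSpace ℝ EG] [FiniteDimensional ℝ EG] [TopologicalSpace HG]
    (IG : ModelWithCorners ℝ EG HG)
    [IG.Boundaryless] [TopologicalSpace G] [ChartedSpace HG G] [Group G] [LieGroup IG ∞ G]
    [CompactSpace G] [T2Space G] :
    ∃ (V : Type u) (_ : NormedAddCommGroup V) (_ : InnerProductSpace ℂ V)
      (_ : FiniteDimensional ℂ V) (ρ : G →* (V →L[ℂ] V)),
      (∀ g v, ‖ρ g v‖ = ‖v‖) ∧ Function.Injective ρ ∧ IsImmersiveRep IG ρ := by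
  have : IsTopologicalGroup G := topologicalGroup_of_lieGroup IG ∞
  let _ : MeasurableSpace G := borel G
  have : BorelSpace G := ⟨rfl⟩
  let μ : Measure G := Measure.haarMeasure ⊤
  obtain ⟨W, hW, himm, hinj⟩ :=
    exists_isSmoothSubrep_faithful (smoothSubrepsSeparate_leftRegular (IG := IG) μ)
  exact ⟨W, inferInstance, inferInstance, hW.finiteDimensional, hW.hom,
    fun g v => (leftRegular μ g).norm_map v, hinj, himm⟩
section Characters

variable {A V : Type*} [CommGroup A] [TopologicalSpace A]
  [NormedAddCommGroup V] [InnerProductSpace ℂ V]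

theorem exists_character_of_forall_smul {ρ : A →* (V →L[ℂ] V)} (hρ : ∀ a v, ‖ρ a v‖ = ‖v‖)
    (hcont : ∀ v, Continuous fun a => ρ a v) {E : Submodule ℂ V} (hE : E ≠ ⊥) {c : A → ℂ}
    (hc : ∀ a, ∀ v ∈ E, ρ a v = c a • v) :
    ∃ χ : A →ₜ* Circle, ∀ a, ∀ v ∈ E, ρ a v = (χ a : ℂ) • v := by
  obtain ⟨v, hv, hv0⟩ := E.ne_bot_iff.1 hE
  have hcancel {x y : ℂ} (h : x • v = y • v) : x = y := smul_left_injective ℂ hv0 h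
  have hsphere (a : A) : c a ∈ Submonoid.unitSphere ℂ := by
    have h := hρ a v
    rw [hc a v hv, norm_smul] at h
    exact mem_sphere_zero_iff_norm.2 ((mul_eq_right₀ (norm_ne_zero_iff.2 hv0)).1 h)
  have hcontinuous : Continuous c := by
    have h : c = fun a => inner ℂ v (ρ a v) / inner ℂ v v := by
      ext a
      rw [hc a v hv, inner_smul_right, mul_div_cancel_right₀ _ (inner_self_ne_zero.2 hv0)]
    rw [h]
    exact (continuous_const.inner (hcont v)).div_const _
  have hone : c 1 = 1 := hcancel (by rw [← hc 1 v hv, map_one, one_smul, one_apply_eq_self])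
  have hmul (a b : A) : c (a * b) = c a * c b := hcancel (by
    rw [← hc _ v hv, map_mul, mul_apply_eq_comp, hc b v hv, map_smul, hc a v hv, smul_smul,
      mul_comm])
  exact ⟨{ toFun := fun a => ⟨c a, hsphere a⟩
           map_one' := Subtype.ext hone
           map_mul' := fun a b => Subtype.ext (hmul a b)
           continuous_toFun := hcontinuous.subtype_mk _ }, hc⟩

variable [FiniteDimensional ℂ V]

theorem isSemisimple_of_isometry (T : V →ₗᵢ[ℂ] V) :
    Module.End.IsSemisimple (T.toLinearMap : Module.End ℂ V) := by
  refine Module.End.isSemisimple_iff.2 fun p hp =>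
    ⟨pᗮ, fun x hx => (Submodule.mem_orthogonal _ _).2 fun y hy => ?_,
      p.isCompl_orthogonal⟩
  have hmap : p.map T.toLinearMap = p := Submodule.eq_of_le_of_finrank_eq
    (Submodule.map_le_iff_le_comap.2 hp) (p.equivMapOfInjective _ T.injective).finrank_eq.symm
  obtain ⟨z, hz, rfl⟩ : y ∈ p.map T.toLinearMap := hmap.ge hy
  exact (T.inner_map_map z x).trans ((Submodule.mem_orthogonal _ _).1 hx z hz)

theorem exists_finite_characters {ρ : A →* (V →L[ℂ] V)}
    (hρ : ∀ a v, ‖ρ a v‖ = ‖v‖) (hcont : ∀ v, Continuous fun a => ρ a v) :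
    ∃ s : Set (A →ₜ* Circle), s.Finite ∧ ∀ a, (∀ χ ∈ s, χ a = 1) → ρ a = 1 := by
  let T (a : A) : Module.End ℂ V := (ρ a).toLinearMap
  have hcomm (a b : A) : Commute (T a) (T b) := LinearMap.ext fun v => by
    simp only [T, Module.End.mul_apply, ContinuousLinearMap.coe_coe, ← mul_apply_eq_comp,
      ← map_mul, mul_comm]
  let E (c : A → ℂ) : Submodule ℂ V := ⨅ a, (T a).maxGenEigenspace (c a)
  have hsup : ⨆ c, E c = ⊤ :=
    Module.End.iSup_iInf_maxGenEigenspace_eq_top_of_iSup_maxGenEigenspace_eq_top_of_commute T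
      (fun a b _ => hcomm a b) fun a => Module.End.iSup_maxGenEigenspace_eq_top (T a)
  have hfinite : {c | E c ≠ ⊥}.Finite := WellFoundedGT.finite_ne_bot_of_iSupIndep
    (Module.End.independent_iInf_maxGenEigenspace_of_forall_mapsTo T fun a b c =>
      Module.End.mapsTo_maxGenEigenspace_of_comm (hcomm b a) c)
  have hsmul (c : A → ℂ) (a : A) (v : V) (hv : v ∈ E c) : ρ a v = c a • v := by
    have hss := isSemisimple_of_isometry ⟨T a, hρ a⟩
    have hv' := (Submodule.mem_iInf _).1 hv a
    rw [hss.isFinitelySemisimple.maxGenEigenspace_eq_eigenspace] at hv'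
    exact Module.End.mem_eigenspace_iff.1 hv'
  choose! χ hχ using fun (c : A → ℂ) (hc : E c ≠ ⊥) =>
    exists_character_of_forall_smul hρ hcont hc (hsmul c)
  refine ⟨χ '' {c | E c ≠ ⊥}, hfinite.image χ, fun a ha => ?_⟩
  have hle : ⨆ c, E c ≤ LinearMap.eqLocus (T a) 1 := iSup_le fun c v hv => by
    rcases eq_or_ne (E c) ⊥ with hc | hc
    · rw [hc, Submodule.mem_bot] at hv
      simp [hv]
    · exact (hχ c hc a v hv).trans (by rw [ha _ ⟨c, hc, rfl⟩, Circle.coe_one, one_smul]; rfl)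
  exact ContinuousLinearMap.ext fun v => hle (hsup.ge (Submodule.mem_top (x := v)))

end Characters
section Characters

theorem integral_character_eq_zero {K : Type*} [Group K] [TopologicalSpace K]
    [IsTopologicalGroup K] [MeasurableSpace K] [BorelSpace K] (μ : Measure K)
    [μ.IsMulLeftInvariant] {χ : K →* Circle} (hχ : χ ≠ 1) :
    ∫ x, (χ x : ℂ) ∂μ = 0 := by
  obtain ⟨a, ha⟩ := DFunLike.ne_iff.1 hχ
  have h := integral_mul_left_eq_self (μ := μ) (fun x => (χ x : ℂ)) a
  simp only [map_mul, Circle.coe_mul] at h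
  rw [integral_const_mul] at h
  have hne : (χ a : ℂ) - 1 ≠ 0 := fun h0 => ha (Circle.ext (sub_eq_zero.1 h0))
  refine (mul_eq_zero.1 (?_ : ((χ a : ℂ) - 1) * _ = 0)).resolve_left hne
  rw [sub_mul, h, one_mul, sub_self]

/-- A unitary character, regarded as a complex-valued function. -/
noncomputable def characterFunction {T : Type*} [Monoid T] [TopologicalSpace T] :
    (T →ₜ* Circle) →* C(T, ℂ) where
  toFun χ := ⟨fun t => χ t, continuous_subtype_val.comp χ.continuous_toFun⟩
  map_one' := rfl
  map_mul' _ _ := rfl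

theorem span_characterFunction_closure_eq_top {T : Type*} [Monoid T] [TopologicalSpace T]
    [CompactSpace T] {M : Subgroup (T →ₜ* Circle)}
    (hM : ∀ ⦃x y : T⦄, x ≠ y → ∃ χ ∈ M, χ x ≠ χ y) :
    (Submodule.span ℂ (characterFunction '' (M : Set (T →ₜ* Circle)))).topologicalClosure = ⊤ := by
  let S : Submonoid C(T, ℂ) := M.toSubmonoid.map characterFunction
  have hstar : ∀ f ∈ S, star f ∈ S := by
    rintro _ ⟨χ, hχ, rfl⟩
    exact ⟨χ⁻¹, M.inv_mem hχ, ContinuousMap.ext fun t => Circle.coe_inv_eq_conj (χ t)⟩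
  have hle : Algebra.adjoin ℂ (S : Set C(T, ℂ)) ≤ star (Algebra.adjoin ℂ (S : Set C(T, ℂ))) :=
    Algebra.adjoin_le fun f hf => Algebra.subset_adjoin (hstar f hf)
  let B : StarSubalgebra ℂ C(T, ℂ) :=
    { Algebra.adjoin ℂ (S : Set C(T, ℂ)) with star_mem' := fun hf => hle hf }
  have hB : B.topologicalClosure = ⊤ :=
    ContinuousMap.starSubalgebra_topologicalClosure_eq_top_of_separatesPoints B fun x y hxy => by
      obtain ⟨χ, hχ, hne⟩ := hM hxy
      exact ⟨_, ⟨characterFunction χ, Algebra.subset_adjoin ⟨χ, hχ, rfl⟩, rfl⟩,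
        fun h => hne (Circle.ext h)⟩
  have hspan : B.toSubalgebra.toSubmodule =
      Submodule.span ℂ (characterFunction '' (M : Set (T →ₜ* Circle))) :=
    (Algebra.adjoin_eq_span ℂ _).trans (by rw [Submonoid.closure_eq]; rfl)
  rw [← hspan]
  exact congrArg (fun B : StarSubalgebra ℂ C(T, ℂ) => B.toSubalgebra.toSubmodule) hB

/-- Integration of functions on a space along a map from a compact measure space to it. -/
noncomputable def integralAlong {K X : Type*} [TopologicalSpace K] [CompactSpace K]
    [MeasurableSpace K] [BorelSpace K] [TopologicalSpace X] [CompactSpace X] (μ : Measure K)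
    [IsFiniteMeasure μ] (j : C(K, X)) : C(X, ℂ) →L[ℂ] ℂ :=
  have hint (F : C(X, ℂ)) : Integrable (fun k => F (j k)) μ :=
    Continuous.integrable_of_hasCompactSupport (by fun_prop) (HasCompactSupport.of_compactSpace _)
  LinearMap.mkContinuous
    { toFun := fun F => ∫ k, F (j k) ∂μ
      map_add' := fun F F' => integral_add (hint F) (hint F')
      map_smul' := fun c F => integral_smul c _ }
    (μ.real Set.univ) fun F => by
      rw [mul_comm]
      exact norm_integral_le_of_norm_le_const (Filter.Eventually.of_forall fun k =>
        F.norm_coe_le_norm _)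

theorem integralAlong_apply {K X : Type*} [TopologicalSpace K] [CompactSpace K]
    [MeasurableSpace K] [BorelSpace K] [TopologicalSpace X] [CompactSpace X] (μ : Measure K)
    [IsFiniteMeasure μ] (j : C(K, X)) (F : C(X, ℂ)) :
    integralAlong μ j F = ∫ k, F (j k) ∂μ := rfl

variable {K T : Type*} [Group K] [TopologicalSpace K] [IsTopologicalGroup K] [CompactSpace K]

theorem integralAlong_characterFunction [MeasurableSpace K] [BorelSpace K] [Monoid T]
    [TopologicalSpace T] [CompactSpace T] (μ : Measure K) [μ.IsMulLeftInvariant]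
    [IsProbabilityMeasure μ] (j : K →ₜ* T) {χ : T →ₜ* Circle} (hχ : χ.comp j = 1 → χ = 1)
    [Decidable (χ = 1)] :
    integralAlong μ (j : C(K, T)) (characterFunction χ) = if χ = 1 then 1 else 0 := by
  rw [integralAlong_apply]
  split_ifs with h
  · simp [h]
  · refine integral_character_eq_zero μ (χ := (χ.comp j).toMonoidHom) fun h1 => h (hχ ?_)
    exact ContinuousMonoidHom.ext fun k => DFunLike.congr_fun h1 k

variable [Group T] [TopologicalSpace T] [IsTopologicalGroup T] [CompactSpace T]

open Classical in
theorem integralAlong_eq_of_characters [MeasurableSpace K] [BorelSpace K] [MeasurableSpace T]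
    [BorelSpace T] (μ : Measure K) [μ.IsMulLeftInvariant] [IsProbabilityMeasure μ]
    (ν : Measure T) [ν.IsMulLeftInvariant] [IsProbabilityMeasure ν] (j : K →ₜ* T)
    {M : Subgroup (T →ₜ* Circle)} (hM : ∀ ⦃x y : T⦄, x ≠ y → ∃ χ ∈ M, χ x ≠ χ y)
    (hj : ∀ χ ∈ M, χ.comp j = 1 → χ = 1) :
    integralAlong μ (j : C(K, T)) = integralAlong ν (ContinuousMap.id T) := by
  refine ContinuousLinearMap.ext_on
    (Submodule.dense_iff_topologicalClosure_eq_top.2 (span_characterFunction_closure_eq_top hM)) ?_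
  rintro _ ⟨χ, hχ, rfl⟩
  rw [integralAlong_characterFunction μ j (hj χ hχ)]
  exact (integralAlong_characterFunction ν (ContinuousMonoidHom.id T) id).symm

theorem surjective_of_characters [T2Space T] (j : K →ₜ* T) {M : Subgroup (T →ₜ* Circle)}
    (hM : ∀ ⦃x y : T⦄, x ≠ y → ∃ χ ∈ M, χ x ≠ χ y) (hj : ∀ χ ∈ M, χ.comp j = 1 → χ = 1) :
    Function.Surjective j := by
  by_contra hsurj
  obtain ⟨y, hy⟩ := not_forall.1 hsurj
  borelize K T
  let μ : Measure K := Measure.haarMeasure ⊤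
  have : IsProbabilityMeasure μ := ⟨Measure.haarMeasure_self⟩
  let ν : Measure T := Measure.haarMeasure ⊤
  have : IsProbabilityMeasure ν := ⟨Measure.haarMeasure_self⟩
  have hclosed : IsClosed (Set.range j) := (isCompact_range j.continuous_toFun).isClosed
  obtain ⟨f, hf0, hf1, hf01⟩ := exists_continuous_zero_one_of_isClosed hclosed
    (isClosed_singleton (x := y)) (Set.disjoint_singleton_right.2 hy)
  let F : C(T, ℂ) := ⟨fun x => (f x : ℂ), by fun_prop⟩
  have hμ : integralAlong μ (j : C(K, T)) F = 0 := by
    refine integral_eq_zero_of_ae (Filter.Eventually.of_forall fun k => ?_)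
    have : f (j k) = 0 := hf0 ⟨k, rfl⟩
    simp [F, this]
  have hν : integralAlong ν (ContinuousMap.id T) F = ((∫ y, f y ∂ν : ℝ) : ℂ) := by
    rw [integralAlong_apply, ← integral_complex_ofReal]
    rfl
  have hpos : 0 < ∫ y, f y ∂ν :=
    f.continuous.integral_pos_of_hasCompactSupport_nonneg_nonzero
      (HasCompactSupport.of_compactSpace _) (fun x => (hf01 x).1)
      (x := y) (by rw [hf1 rfl]; exact one_ne_zero)
  rw [integralAlong_eq_of_characters μ ν j hM hj, hν, Complex.ofReal_eq_zero] at hμ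
  exact hpos.ne' hμ

end Characters
section TorusRange

theorem exists_zpow_basis_of_finite {X : Type*} [CommGroup X] {s : Set X} (hs : s.Finite)
    (htf : ∀ x ∈ Subgroup.closure s, ∀ k : ℤ, k ≠ 0 → x ^ k = 1 → x = 1) :
    ∃ (n : ℕ) (y : Fin n → X), Subgroup.closure (Set.range y) = Subgroup.closure s ∧
      ∀ m : Fin n → ℤ, ∏ i, y i ^ m i = 1 → m = 0 := by
  let M := Subgroup.closure s
  have hfinite : Module.Finite ℤ (Additive M) := by
    have : Group.FG M := (Group.fg_iff_subgroup_fg M).2 ⟨hs.toFinset, by rw [hs.coe_toFinset]⟩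
    exact Module.Finite.iff_addGroup_fg.2 inferInstance
  have htorsion : Module.IsTorsionFree ℤ (Additive M) :=
    Module.isTorsionFree_iff_smul_eq_zero.2 fun k x h => or_iff_not_imp_left.2 fun hk =>
      Subtype.ext (htf _ x.toMul.2 k hk (congrArg Subtype.val h))
  obtain ⟨n, b⟩ := Module.basisOfFiniteTypeTorsionFree' (R := ℤ) (M := Additive M)
  let y (i : Fin n) : X := ((b i).toMul : M)
  have hprod (m : Fin n → ℤ) : (((∑ i, m i • b i).toMul : M) : X) = ∏ i, y i ^ m i := by
    rw [toMul_sum]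
    simp [y]
  refine ⟨n, y, le_antisymm ?_ fun x hx => ?_, fun m hm => ?_⟩
  · rw [Subgroup.closure_le]
    rintro _ ⟨i, rfl⟩
    exact ((b i).toMul : M).2
  · have h := hprod fun i => b.repr (Additive.ofMul ⟨x, hx⟩) i
    rw [b.sum_repr] at h
    exact Subgroup.mem_closure_range_iff_of_fintype.2 ⟨_, h⟩
  · have h : ∑ i, m i • b i = 0 := Subtype.ext ((hprod m).trans hm)
    exact funext (Fintype.linearIndependent_iff.1 b.linearIndependent m h)

variable {A : Type*} [CommGroup A] [TopologicalSpace A]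

/-- The homomorphism to a torus with prescribed coordinate characters. -/
noncomputable def torusHom {n : ℕ} (y : Fin n → (A →ₜ* Circle)) : A →ₜ* (Fin n → Circle) where
  toMonoidHom := MonoidHom.pi fun i => (y i).toMonoidHom
  continuous_toFun := continuous_pi fun i => (y i).continuous_toFun

/-- Evaluation of characters at a point. -/
noncomputable def evalCharacter (a : A) : (A →ₜ* Circle) →* Circle where
  toFun χ := χ a
  map_one' := rfl
  map_mul' _ _ := rfl

theorem forall_mem_closure_character_eq_one_iff {s : Set (A →ₜ* Circle)} {a : A} :
    (∀ χ ∈ Subgroup.closure s, χ a = 1) ↔ ∀ χ ∈ s, χ a = 1 :=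
  Subgroup.closure_le (evalCharacter a).ker

theorem torusHom_eq_one_iff {n : ℕ} {y : Fin n → (A →ₜ* Circle)} {a : A} :
    torusHom y a = 1 ↔ ∀ χ ∈ Subgroup.closure (Set.range y), χ a = 1 := by
  rw [forall_mem_closure_character_eq_one_iff, Set.forall_mem_range, funext_iff]
  rfl

theorem character_prod_zpow_apply {n : ℕ} (y : Fin n → (A →ₜ* Circle)) (m : Fin n → ℤ) (a : A) :
    (∏ i, y i ^ m i) a = ∏ i, y i a ^ m i := by
  change evalCharacter a (∏ i, y i ^ m i) = _
  rw [map_prod]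
  exact Finset.prod_congr rfl fun i _ => map_zpow (evalCharacter a) (y i) (m i)

theorem torusHom_surjective {n : ℕ} {y : Fin n → (A →ₜ* Circle)}
    (hy : ∀ m : Fin n → ℤ, ∏ i, y i ^ m i = 1 → m = 0)
    (hcompact : IsCompact (Set.range (torusHom y))) : Function.Surjective (torusHom y) := by
  let R := (torusHom y).toMonoidHom.range
  have : CompactSpace R := isCompact_iff_compactSpace.1 hcompact
  let coord (i : Fin n) : (Fin n → Circle) →ₜ* Circle := ⟨Pi.evalMonoidHom _ i, continuous_apply i⟩
  have hsurj : Function.Surjective (⟨R.subtype, continuous_subtype_val⟩ : R →ₜ* _) := by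
    refine surjective_of_characters _ (M := Subgroup.closure (Set.range coord))
      (fun x z hxz => ?_) fun χ hχ h => ?_
    · obtain ⟨i, hi⟩ := Function.ne_iff.1 hxz
      exact ⟨coord i, Subgroup.subset_closure ⟨i, rfl⟩, hi⟩
    · obtain ⟨m, rfl⟩ := Subgroup.exists_of_mem_closure_range _ _ hχ
      have hm : m = 0 := hy m (ContinuousMonoidHom.ext fun a => by
        have ha := DFunLike.congr_fun h (⟨torusHom y a, a, rfl⟩ : R)
        rw [character_prod_zpow_apply]
        exact (character_prod_zpow_apply coord m _).symm.trans ha)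
      simp [hm]
  intro t
  obtain ⟨⟨_, a, rfl⟩, rfl⟩ := hsurj t
  exact ⟨a, rfl⟩

variable {B T : Type*} [Group B] [TopologicalSpace B] [T2Space B]

theorem exists_continuousMulEquiv_range [Group T] [TopologicalSpace T] [T2Space T] (τ : A →ₜ* B)
    (Y : A →ₜ* T) (hY : ∀ a, Y a = 1 ↔ τ a = 1) {C : Set A} (hC : IsCompact C)
    (hYC : Y '' C = Set.univ) : Nonempty (T ≃ₜ* τ.toMonoidHom.range) := by
  have hsurj : Function.Surjective Y := fun t => Set.image_subset_range Y C (hYC.ge trivial)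
  let q := QuotientGroup.quotientKerEquivOfSurjective Y.toMonoidHom hsurj
  have hker : Y.toMonoidHom.ker = τ.toMonoidHom.ker := Subgroup.ext hY
  let f : T ≃* τ.toMonoidHom.range := q.symm.trans
    ((QuotientGroup.quotientMulEquivOfEq hker).trans
      (QuotientGroup.quotientKerEquivRange τ.toMonoidHom))
  have hfY (a : A) : (f (Y a) : B) = τ a := by
    have h : q.symm (Y a) = QuotientGroup.mk a := q.symm_apply_eq.2 rfl
    simp only [f, MulEquiv.trans_apply, h]
    rfl
  have : CompactSpace C := isCompact_iff_compactSpace.1 hC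
  have hcont : Continuous fun c : C => Y c := Y.continuous_toFun.comp continuous_subtype_val
  have hquot : Topology.IsQuotientMap fun c : C => Y c :=
    hcont.isClosedMap.isQuotientMap hcont fun t =>
      let ⟨c, hc, hct⟩ := hYC.ge (Set.mem_univ t)
      ⟨⟨c, hc⟩, hct⟩
  have : CompactSpace T := ⟨hYC ▸ hC.image Y.continuous_toFun⟩
  have hf : Continuous f := hquot.continuous_iff.2 <| continuous_induced_rng.2 <|
    (τ.continuous_toFun.comp continuous_subtype_val).congr fun c : C => (hfY c).symm
  exact ⟨⟨f, hf, (hf.homeoOfEquivCompactToT2 (f := f.toEquiv)).symm.continuous⟩⟩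

theorem isTorusGroup_range (τ : A →ₜ* B) {s : Set (A →ₜ* Circle)} (hs : s.Finite)
    (hker : ∀ a, τ a = 1 ↔ ∀ χ ∈ s, χ a = 1)
    (htf : ∀ χ : A →ₜ* Circle, (∀ a, τ a = 1 → χ a = 1) → ∀ k : ℤ, k ≠ 0 → χ ^ k = 1 → χ = 1)
    {C : Set A} (hC : IsCompact C) (hτC : ∀ a, ∃ c ∈ C, τ c = τ a) :
    IsTorusGroup τ.toMonoidHom.range := by
  obtain ⟨n, y, hclosure, hindep⟩ := exists_zpow_basis_of_finite hs fun χ hχ =>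
    htf χ fun a ha => forall_mem_closure_character_eq_one_iff.2 ((hker a).1 ha) χ hχ
  have hY (a : A) : torusHom y a = 1 ↔ τ a = 1 := by
    rw [torusHom_eq_one_iff, hclosure, forall_mem_closure_character_eq_one_iff, hker]
  have hrange : torusHom y '' C = Set.range (torusHom y) := by
    refine subset_antisymm (Set.image_subset_range _ _) ?_
    rintro _ ⟨a, rfl⟩
    obtain ⟨c, hc, hca⟩ := hτC a
    exact ⟨c, hc, div_eq_one.1 (by rw [← map_div, hY, div_eq_mul_inv, map_mul, map_inv, hca,
      mul_inv_cancel])⟩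
  have hsurj : Function.Surjective (torusHom y) :=
    torusHom_surjective hindep (hrange ▸ hC.image (torusHom y).continuous_toFun)
  obtain ⟨e⟩ := exists_continuousMulEquiv_range τ _ hY hC (hrange.trans hsurj.range_eq)
  exact ⟨n, ⟨e.symm⟩⟩

end TorusRange

section Lattice

open Filter

variable {E : Type*} [NormedAddCommGroup E] [NormedSpace ℝ E]

theorem tendsto_floor_div_mul {ι : Type*} {l : Filter ι} {r : ι → ℝ} (hr : Tendsto r l (𝓝 0))
    (hr0 : ∀ i, 0 < r i) (t : ℝ) : Tendsto (fun i => (⌊t / r i⌋ : ℝ) * r i) l (𝓝 t) := by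
  refine tendsto_of_tendsto_of_dist tendsto_const_nhds
    (squeeze_zero (fun _ => dist_nonneg) (fun i => ?_) hr)
  have hlower : (⌊t / r i⌋ : ℝ) * r i ≤ t := (le_div_iff₀ (hr0 i)).1 (Int.floor_le _)
  have hupper : t < (⌊t / r i⌋ + 1 : ℝ) * r i := (div_lt_iff₀ (hr0 i)).1 (Int.lt_floor_add_one _)
  rw [Real.dist_eq, abs_of_nonneg (by linarith)]
  linarith

theorem smul_mem_of_tendsto_normalized {Λ : AddSubgroup E} (hΛ : IsClosed (Λ : Set E))
    {ι : Type*} {l : Filter ι} [l.NeBot] {x : ι → E} (hx : ∀ i, x i ∈ Λ) (hx0 : ∀ i, x i ≠ 0)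
    (hlim : Tendsto (fun i => ‖x i‖) l (𝓝 0)) {v : E}
    (hv : Tendsto (fun i => ‖x i‖⁻¹ • x i) l (𝓝 v)) (t : ℝ) : t • v ∈ Λ := by
  refine hΛ.mem_of_tendsto
    (((tendsto_floor_div_mul hlim (fun i => norm_pos_iff.2 (hx0 i)) t).smul hv).congr fun i => ?_)
    (Eventually.of_forall fun i => Λ.zsmul_mem (hx i) ⌊t / ‖x i‖⌋)
  rw [smul_smul, mul_assoc, mul_inv_cancel₀ (norm_ne_zero_iff.2 (hx0 i)), mul_one,
    Int.cast_smul_eq_zsmul]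

theorem discreteTopology_of_forall_line_mem_imp_eq_zero [FiniteDimensional ℝ E]
    {Λ : AddSubgroup E} (hΛ : IsClosed (Λ : Set E))
    (hline : ∀ v : E, (∀ t : ℝ, t • v ∈ Λ) → v = 0) : DiscreteTopology Λ := by
  suffices h : ∃ ε > 0, ∀ x ∈ Λ, x ≠ 0 → ε ≤ ‖x‖ by
    obtain ⟨ε, hε, hΛε⟩ := h
    refine discreteTopology_of_isOpen_singleton_zero
      ⟨Metric.ball 0 ε, Metric.isOpen_ball, Set.ext fun x => ?_⟩
    rw [Set.mem_preimage, mem_ball_zero_iff, Set.mem_singleton_iff]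
    refine ⟨fun hx => ?_, fun hx => by simpa [hx] using hε⟩
    by_contra hx0
    exact (hΛε x x.2 fun h => hx0 (Subtype.ext h)).not_gt hx
  by_contra! hacc
  choose x hxΛ hx0 hxε using fun n : ℕ => hacc (1 / (n + 1 : ℝ)) (by positivity)
  have hsphere : ∀ n, ‖x n‖⁻¹ • x n ∈ Metric.sphere (0 : E) 1 := fun n => by
    rw [mem_sphere_zero_iff_norm, norm_smul, norm_inv, norm_norm,
      inv_mul_cancel₀ (norm_ne_zero_iff.2 (hx0 n))]
  have : ProperSpace E := FiniteDimensional.proper_real E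
  obtain ⟨v, hv, φ, hφ, hlim⟩ := (isCompact_sphere (0 : E) 1).tendsto_subseq hsphere
  have hnorm : Tendsto (fun n => ‖x n‖) atTop (𝓝 0) :=
    squeeze_zero (fun _ => norm_nonneg _) (fun n => (hxε n).le)
      tendsto_one_div_add_atTop_nhds_zero_nat
  have hv0 : v = 0 := hline v <| smul_mem_of_tendsto_normalized hΛ (fun n => hxΛ (φ n))
    (fun n => hx0 (φ n)) (hnorm.comp hφ.tendsto_atTop) hlim
  simp [hv0] at hv

theorem isZLattice_of_isCompact [FiniteDimensional ℝ E] {L : Submodule ℤ E} [DiscreteTopology L]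
    {D : Set E} (hD : IsCompact D) (hDL : ∀ z, ∃ d ∈ D, z - d ∈ L) : IsZLattice ℝ L where
  span_top := by
    by_contra hne
    obtain ⟨f, hf0, hf⟩ := Submodule.exists_le_ker_of_lt_top _ (lt_top_iff_ne_top.2 hne)
    obtain ⟨z, hz⟩ := DFunLike.ne_iff.1 hf0
    obtain ⟨C, hC⟩ := (hD.image f.continuous_of_finiteDimensional).isBounded.exists_norm_le
    obtain ⟨d, hd, hdL⟩ := hDL (((C + 1) / f z) • z)
    have hfd : f (((C + 1) / f z) • z - d) = 0 := hf (Submodule.subset_span hdL)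
    rw [map_sub, map_smul, smul_eq_mul, div_mul_cancel₀ _ hz] at hfd
    have hle : f d ≤ C := (Real.le_norm_self _).trans (hC _ ⟨d, hd, rfl⟩)
    linarith

/-- The lineality space of a subgroup: the largest vector subspace that it contains. -/
def lineality (Λ : AddSubgroup E) : Submodule ℝ E where
  carrier := {v | ∀ t : ℝ, t • v ∈ Λ}
  zero_mem' t := by rw [smul_zero]; exact Λ.zero_mem
  add_mem' hv hw t := by rw [smul_add]; exact Λ.add_mem (hv t) (hw t)
  smul_mem' c v hv t := by rw [smul_smul]; exact hv (t * c)

theorem mem_of_mem_lineality {Λ : AddSubgroup E} {v : E} (hv : v ∈ lineality Λ) : v ∈ Λ := by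
  simpa using hv 1

theorem discreteTopology_comap_of_isCompl_lineality [FiniteDimensional ℝ E] {Λ : AddSubgroup E}
    (hΛ : IsClosed (Λ : Set E)) {W : Submodule ℝ E} (hW : IsCompl (lineality Λ) W) :
    DiscreteTopology (Λ.comap W.subtype.toAddMonoidHom) :=
  discreteTopology_of_forall_line_mem_imp_eq_zero (hΛ.preimage continuous_subtype_val) fun w hw =>
    Subtype.ext (Submodule.disjoint_def.1 hW.disjoint w hw w.2)

theorem sub_projectionOnto_mem {V W : Submodule ℝ E} (h : IsCompl V W) (z : E) :
    z - W.projectionOnto V h.symm z ∈ V := by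
  rw [← Submodule.projectionOnto_apply_eq_zero_iff h.symm, map_sub,
    Submodule.projectionOnto_apply_left, sub_self]

theorem exists_isCompact_comap_of_isCompl_lineality [FiniteDimensional ℝ E] {Λ : AddSubgroup E}
    {W : Submodule ℝ E} (hW : IsCompl (lineality Λ) W) {D : Set E} (hD : IsCompact D)
    (hDΛ : ∀ z, ∃ d ∈ D, z - d ∈ Λ) :
    ∃ D' : Set W, IsCompact D' ∧
      ∀ w, ∃ d ∈ D', w - d ∈ Λ.comap W.subtype.toAddMonoidHom := by
  let p : E →ₗ[ℝ] W := W.projectionOnto (lineality Λ) hW.symm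
  refine ⟨p '' D, hD.image p.continuous_of_finiteDimensional, fun w => ?_⟩
  obtain ⟨d, hd, hdΛ⟩ := hDΛ w
  refine ⟨p d, ⟨d, hd, rfl⟩, ?_⟩
  have hadd := Λ.add_mem hdΛ (mem_of_mem_lineality (sub_projectionOnto_mem hW d))
  rwa [sub_add_sub_cancel] at hadd

end Lattice

section LatticeCharacters

variable {E : Type*} [NormedAddCommGroup E] [NormedSpace ℝ E] [FiniteDimensional ℝ E]

/-- The character `z ↦ exp (i ℓ(z))` of a finite-dimensional real vector space given by a linear
functional `ℓ`. -/
noncomputable def expCharacter (ℓ : E →ₗ[ℝ] ℝ) : Multiplicative E →ₜ* Circle where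
  toFun z := Circle.exp (ℓ z.toAdd)
  map_one' := by simp
  map_mul' z w := by simp [Circle.exp_add]
  continuous_toFun := Circle.exp.continuous.comp
    (ℓ.continuous_of_finiteDimensional.comp continuous_toAdd)

theorem expCharacter_ofAdd (ℓ : E →ₗ[ℝ] ℝ) (z : E) :
    expCharacter ℓ (Multiplicative.ofAdd z) = Circle.exp (ℓ z) := rfl

variable (L : Submodule ℤ E) [DiscreteTopology L] [IsZLattice ℝ L]

theorem exists_character_extension (φ : Multiplicative L →* Circle) :
    ∃ ψ : Multiplicative E →ₜ* Circle,
      ∀ l : L, ψ (Multiplicative.ofAdd (l : E)) = φ (Multiplicative.ofAdd l) := by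
  have := ZLattice.module_free ℝ L
  let b := Module.Free.chooseBasis ℤ L
  let ℓ : E →ₗ[ℝ] ℝ := (b.ofZLatticeBasis ℝ L).constr ℝ fun i =>
    Complex.arg (φ (Multiplicative.ofAdd (b i)))
  have hℓ : ∀ i, Circle.exp (ℓ (b i)) = φ (Multiplicative.ofAdd (b i)) := fun i => by
    rw [← b.ofZLatticeBasis_apply ℝ L i, Module.Basis.constr_basis, Circle.exp_arg]
  have hext : (MonoidHom.toAdditiveRight
      ((expCharacter ℓ).toMonoidHom.comp L.toAddSubgroup.subtype.toMultiplicative)).toIntLinearMap =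
      (MonoidHom.toAdditiveRight φ).toIntLinearMap :=
    b.ext hℓ
  exact ⟨expCharacter ℓ, DFunLike.congr_fun hext⟩

theorem exists_finite_characters_mem_iff : ∃ s : Set (Multiplicative E →ₜ* Circle), s.Finite ∧
    ∀ z, z ∈ L ↔ ∀ χ ∈ s, χ (Multiplicative.ofAdd z) = 1 := by
  have := ZLattice.module_free ℝ L
  let b := (Module.Free.chooseBasis ℤ L).ofZLatticeBasis ℝ L
  have hb : Submodule.span ℤ (Set.range b) = L := Module.Basis.ofZLatticeBasis_span ℝ L _
  refine ⟨_, Set.finite_range fun i => expCharacter ((2 * Real.pi) • b.coord i), fun z => ?_⟩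
  rw [Set.forall_mem_range, ← SetLike.mem_coe, ← congrArg SetLike.coe hb, SetLike.mem_coe,
    b.mem_span_iff_repr_mem ℤ z]
  refine forall_congr' fun i => ?_
  rw [expCharacter_ofAdd, Circle.exp_eq_one]
  refine exists_congr fun n => ?_
  rw [algebraMap_int_eq, eq_intCast, LinearMap.smul_apply, Module.Basis.coord_apply, smul_eq_mul,
    mul_comm (n : ℝ), mul_right_inj' Real.two_pi_pos.ne', eq_comm]

end LatticeCharacters

theorem exists_isCompact_forall_exists_smul_eq {A X : Type*} [Group A] [TopologicalSpace A]
    [IsTopologicalGroup A] [LocallyCompactSpace A] [SigmaCompactSpace A] [TopologicalSpace X]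
    [CompactSpace X] [T2Space X] [MulAction A X] [ContinuousSMul A X]
    [MulAction.IsPretransitive A X] (x : X) :
    ∃ D : Set A, IsCompact D ∧ ∀ y : X, ∃ a ∈ D, a • x = y := by
  let K := CompactExhaustion.choice A
  obtain ⟨n, hn⟩ := isCompact_univ.elim_directed_cover
    (fun n => (fun a : A => a • x) '' interior (K n))
    (fun n => isOpenMap_smul_of_sigmaCompact x _ isOpen_interior)
    (fun y _ => by
      obtain ⟨a, rfl⟩ := MulAction.exists_smul_eq A x y
      obtain ⟨n, hn⟩ := K.exists_mem a
      exact Set.mem_iUnion.2 ⟨n + 1, a, K.subset_interior_succ n hn, rfl⟩)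
    (directed_of_isDirected_le fun _ _ hmn => Set.image_mono (interior_mono (K.subset hmn)))
  refine ⟨K n, K.isCompact n, fun y => ?_⟩
  obtain ⟨a, ha, hay⟩ := hn (Set.mem_univ y)
  exact ⟨a, interior_subset ha, hay⟩

section PrincipalBundle

variable
    {EG HG EP HP ES HS : Type*}
    [NormedAddCommGroup EG] [NormedSpace ℝ EG] [TopologicalSpace HG]
    [NormedAddCommGroup EP] [NormedSpace ℝ EP] [TopologicalSpace HP]
    [NormedAddCommGroup ES] [NormedSpace ℝ ES] [TopologicalSpace HS]
    {IG : ModelWithCorners ℝ EG HG} {IP : ModelWithCorners ℝ EP HP} {IS : ModelWithCorners ℝ ES HS}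
    {G P S : Type*}
    [TopologicalSpace G] [ChartedSpace HG G] [Group G]
    [TopologicalSpace P] [ChartedSpace HP P]
    [TopologicalSpace S] [ChartedSpace HS S]

namespace SmoothPrincipalBundle

variable (ξ : SmoothPrincipalBundle IG IP IS G P S)

/-- A smooth equivariant local trivialization of a principal bundle. -/
structure IsSmoothTrivialization (e : Bundle.Trivialization G ξ.proj) : Prop where
  contMDiffOn : ContMDiffOn IP (IS.prod IG) ∞ e e.source
  contMDiffOn_symm :
    ContMDiffOn (IS.prod IG) IP ∞ e.toOpenPartialHomeomorph.symm e.target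
  snd_act : ∀ p ∈ e.source, ∀ g : G, (e (ξ.act p g)).2 = (e p).2 * g

theorem exists_isSmoothTrivialization (b : S) :
    ∃ e : Bundle.Trivialization G ξ.proj, b ∈ e.baseSet ∧ ξ.IsSmoothTrivialization e :=
  let ⟨e, hb, he, hes, hact⟩ := ξ.locally_trivial b
  ⟨e, hb, he, hes, hact⟩

theorem continuous_act : Continuous fun q : P × G => ξ.act q.1 q.2 := ξ.contMDiff_act.continuous

theorem continuous_proj : Continuous ξ.proj := ξ.contMDiff_proj.continuous

variable {ξ} {e : Bundle.Trivialization G ξ.proj}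

variable (e) in
/-- The local section that a local trivialization identifies with the constant function `1`. -/
noncomputable def unitSection (x : S) : P := e.toOpenPartialHomeomorph.symm (x, 1)

theorem proj_unitSection {x : S} (hx : x ∈ e.baseSet) : ξ.proj (unitSection e x) = x :=
  e.proj_symm_apply' hx

theorem unitSection_mem_source {x : S} (hx : x ∈ e.baseSet) : unitSection e x ∈ e.source :=
  e.mem_source.2 ((proj_unitSection hx).symm ▸ hx)

namespace IsSmoothTrivialization

theorem contMDiffOn_unitSection (he : ξ.IsSmoothTrivialization e) :
    ContMDiffOn IS IP ∞ (unitSection e) e.baseSet :=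
  he.contMDiffOn_symm.comp (contMDiff_id.prodMk contMDiff_const).contMDiffOn
    fun _ hx => e.mem_target.2 hx

theorem snd_act_unitSection (he : ξ.IsSmoothTrivialization e) {x : S} (hx : x ∈ e.baseSet)
    (g : G) : (e (ξ.act (unitSection e x) g)).2 = g := by
  rw [he.snd_act _ (unitSection_mem_source hx), unitSection, e.apply_symm_apply' hx, one_mul]

theorem act_unitSection (he : ξ.IsSmoothTrivialization e) {p : P} (hp : p ∈ e.source) :
    ξ.act (unitSection e (ξ.proj p)) (e p).2 = p := by
  have hb : ξ.proj p ∈ e.baseSet := e.mem_source.1 hp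
  have hs : ξ.act (unitSection e (ξ.proj p)) (e p).2 ∈ e.source :=
    e.mem_source.2 (by rwa [ξ.proj_act, proj_unitSection hb])
  refine e.injOn hs hp (Prod.ext ?_ (he.snd_act_unitSection hb _))
  exact (e.coe_fst hs).trans (by rw [ξ.proj_act, proj_unitSection hb]; exact (e.coe_fst hp).symm)

end IsSmoothTrivialization

theorem act_injective (p : P) : Function.Injective (ξ.act p) := by
  intro g g' h
  obtain ⟨e, hb, he⟩ := ξ.exists_isSmoothTrivialization (ξ.proj p)
  have hact := he.snd_act p (e.mem_source.2 hb)
  exact mul_left_cancel ((hact g).symm.trans ((congrArg (fun q => (e q).2) h).trans (hact g')))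

theorem exists_act_eq {p q : P} (h : ξ.proj p = ξ.proj q) : ∃ g, ξ.act p g = q := by
  obtain ⟨e, hb, he⟩ := ξ.exists_isSmoothTrivialization (ξ.proj p)
  refine ⟨(e p).2⁻¹ * (e q).2, ?_⟩
  nth_rewrite 1 [← he.act_unitSection (e.mem_source.2 hb)]
  rw [← ξ.act_mul, mul_inv_cancel_left, h, he.act_unitSection (e.mem_source.2 (h ▸ hb))]

section Gauge

variable {c : P → G}

theorem IsSmoothTrivialization.contMDiffOn_comp_unitSection
    (he : ξ.IsSmoothTrivialization e) (hφ : ContMDiff IP IP ∞ fun q => ξ.act q (c q)) :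
    ContMDiffOn IS IG ∞ (fun x => c (unitSection e x)) e.baseSet :=
  (ContMDiffOn.comp (t := e.source) (contMDiff_snd.comp_contMDiffOn he.contMDiffOn)
    (hφ.comp_contMDiffOn he.contMDiffOn_unitSection) fun x hx => e.mem_source.2 <| by
      rwa [Function.comp_apply, ξ.proj_act, proj_unitSection hx]).congr
    fun _ hx => (he.snd_act_unitSection hx _).symm

theorem IsSmoothTrivialization.continuousOn_comp_unitSection
    (he : ξ.IsSmoothTrivialization e) (hφ : Continuous fun q => ξ.act q (c q)) :
    ContinuousOn (fun x => c (unitSection e x)) e.baseSet :=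
  (ContinuousOn.comp (t := e.source) (continuous_snd.comp_continuousOn he.contMDiffOn.continuousOn)
    (hφ.comp_continuousOn he.contMDiffOn_unitSection.continuousOn) fun x hx => e.mem_source.2 <| by
      rwa [Function.comp_apply, ξ.proj_act, proj_unitSection hx]).congr
    fun _ hx => (he.snd_act_unitSection hx _).symm

theorem contMDiff_act_self_of_unitSection
    (hφ : ∀ q g, ξ.act (ξ.act q g) (c (ξ.act q g)) = ξ.act (ξ.act q (c q)) g)
    (hc : ∀ e, ξ.IsSmoothTrivialization e →
      ContMDiffOn IS IG ∞ (fun x => c (unitSection e x)) e.baseSet) :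
    ContMDiff IP IP ∞ fun q => ξ.act q (c q) := by
  intro q
  obtain ⟨e, hq, he⟩ := ξ.exists_isSmoothTrivialization (ξ.proj q)
  have hproj : ContMDiffOn IP IS ∞ ξ.proj e.source := ξ.contMDiff_proj.contMDiffOn
  have hmaps : Set.MapsTo ξ.proj e.source e.baseSet := fun p hp => e.mem_source.1 hp
  have hfactored : ContMDiffOn IP IP ∞ (fun p => ξ.act
      (ξ.act (unitSection e (ξ.proj p)) (c (unitSection e (ξ.proj p)))) (e p).2) e.source :=
    ξ.contMDiff_act.comp_contMDiffOn ((ξ.contMDiff_act.comp_contMDiffOn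
      ((he.contMDiffOn_unitSection.comp hproj hmaps).prodMk ((hc e he).comp hproj hmaps))).prodMk
        (contMDiff_snd.comp_contMDiffOn he.contMDiffOn))
  refine (hfactored.congr fun p hp => ?_).contMDiffAt (e.open_source.mem_nhds (e.mem_source.2 hq))
  rw [← hφ, he.act_unitSection hp]

end Gauge

end SmoothPrincipalBundle

namespace BundleAut

variable {ξ : SmoothPrincipalBundle IG IP IS G P S}

noncomputable instance : MulAction (BundleAut ξ) P where
  smul f p := f.toDiffeo p
  one_smul _ := rfl
  mul_smul _ _ _ := rfl

noncomputable instance : MulAction (BundleAut ξ) S where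
  smul f b := f.baseDiffeo b
  one_smul _ := rfl
  mul_smul _ _ _ := rfl

theorem smul_act (f : BundleAut ξ) (p : P) (g : G) : f • ξ.act p g = ξ.act (f • p) g :=
  f.map_act p g

theorem proj_smul (f : BundleAut ξ) (p : P) : ξ.proj (f • p) = f • ξ.proj p := f.covers p

theorem continuous_toContinuousMap :
    Continuous (toContinuousMap : BundleAut ξ → C(P, P)) := continuous_induced_dom

theorem continuous_of_continuous_smul {X : Type*} [TopologicalSpace X] {f : X → BundleAut ξ}
    (hf : Continuous fun q : X × P => f q.1 • q.2) : Continuous f :=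
  continuous_induced_rng.2
    (ContinuousMap.continuous_of_continuous_uncurry (fun x => (f x).toContinuousMap) hf)

instance [T2Space P] : T2Space (BundleAut ξ) :=
  T2Space.of_injective_continuous (f := toContinuousMap)
    (fun _ _ h => ext_total fun p => congrArg (fun F : C(P, P) => F p) h)
    continuous_toContinuousMap

instance [LocallyCompactSpace P] : ContinuousSMul (BundleAut ξ) P :=
  ⟨ContinuousEval.continuous_eval.comp (continuous_toContinuousMap.prodMap continuous_id)⟩

instance [LocallyCompactSpace P] : ContinuousSMul (BundleAut ξ) S where
  continuous_smul := continuous_iff_continuousAt.2 fun ⟨f, b⟩ => by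
    obtain ⟨e, hb, he⟩ := ξ.exists_isSmoothTrivialization b
    have hs : ContinuousAt (SmoothPrincipalBundle.unitSection e) b :=
      he.contMDiffOn_unitSection.continuousOn.continuousAt (e.open_baseSet.mem_nhds hb)
    have hlift : ContinuousAt (fun q : BundleAut ξ × S =>
        ξ.proj (q.1 • SmoothPrincipalBundle.unitSection e q.2)) (f, b) :=
      ξ.continuous_proj.continuousAt.comp
        (continuousAt_fst.smul
          (ContinuousAt.comp (f := Prod.snd) (x := (f, b)) hs continuousAt_snd))
    refine hlift.congr ?_
    filter_upwards [continuousAt_snd.preimage_mem_nhds (e.open_baseSet.mem_nhds hb)] with q hq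
    rw [proj_smul, SmoothPrincipalBundle.proj_unitSection hq]

end BundleAut

end PrincipalBundle

section ImmersiveRep

variable {V : Type*} [NormedAddCommGroup V] [InnerProductSpace ℂ V]
    {EG HG G : Type*} [NormedAddCommGroup EG] [NormedSpace ℝ EG] [TopologicalSpace HG]
    {IG : ModelWithCorners ℝ EG HG} [TopologicalSpace G] [ChartedSpace HG G] [Group G]
    [LieGroup IG ∞ G]
    {E H M : Type*} [NormedAddCommGroup E] [NormedSpace ℝ E] [TopologicalSpace H]
    {I : ModelWithCorners ℝ E H} [TopologicalSpace M] [ChartedSpace H M]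
    {ρ : G →* (V →L[ℂ] V)}

theorem IsImmersiveRep.contMDiffAt (hρ : IsImmersiveRep IG ρ) {f : M → G} {x : M}
    (hf : ContinuousAt f x)
    (hρf : ContMDiffAt I 𝓘(ℝ, V →L[ℂ] V) ∞ (fun y => ρ (f y)) x) :
    ContMDiffAt I IG ∞ f x := by
  have : IsTopologicalGroup G := topologicalGroup_of_lieGroup IG ∞
  obtain ⟨r, hr, hrρ⟩ := hρ.exists_leftInverse
  have htranslate : ContMDiffAt I 𝓘(ℝ, V →L[ℂ] V) ∞ (fun y => ρ (f x)⁻¹ * ρ (f y)) x :=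
    ((ContinuousLinearMap.mul ℂ (V →L[ℂ] V) (ρ (f x)⁻¹)).restrictScalars ℝ).contMDiff
      |>.contMDiffAt.comp x hρf
  have hlocal : ContMDiffAt I IG ∞ (fun y => f x * r (ρ (f x)⁻¹ * ρ (f y))) x := by
    refine contMDiffAt_const.mul (ContMDiffAt.comp x ?_ htranslate)
    rwa [← map_mul, inv_mul_cancel, map_one]
  refine hlocal.congr_of_eventuallyEq ?_
  have htendsto : Filter.Tendsto (fun y => (f x)⁻¹ * f y) (𝓝 x) (𝓝 1) := by
    simpa only [inv_mul_cancel] using (hf.const_mul (f x)⁻¹).tendsto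
  filter_upwards [htendsto.eventually hrρ] with y hy
  rw [← map_mul, hy, mul_inv_cancel_left]

-- In finite dimensions `ρ η` lies in the span of `ρ '' R`, and the matrix entries of
-- `ρ (u⁻¹ * η * u)` depend linearly on `ρ η`.
theorem IsImmersiveRep.contMDiffOn_conj_of_mem_closure [FiniteDimensional ℂ V]
    (hρ : IsImmersiveRep IG ρ) {R : Set G} {u : M → G} {U : Set M} (hU : IsOpen U)
    (hR : ∀ g ∈ R, ContMDiffOn I IG ∞ (fun x => (u x)⁻¹ * g * u x) U) {η : G} (hη : η ∈ closure R)
    (hcont : ContinuousOn (fun x => (u x)⁻¹ * η * u x) U) :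
    ContMDiffOn I IG ∞ (fun x => (u x)⁻¹ * η * u x) U := by
  have hspan : ρ η ∈ Submodule.span ℂ (ρ '' R) :=
    (closure_minimal Submodule.subset_span (Submodule.closed_of_finiteDimensional _) :
      closure (ρ '' R) ⊆ _) (image_closure_subset_closure_image hρ.smooth.continuous ⟨η, hη, rfl⟩)
  have hconj : ∀ T ∈ Submodule.span ℂ (ρ '' R),
      ContMDiffOn I 𝓘(ℝ, V →L[ℂ] V) ∞ (fun x => ρ (u x)⁻¹ * T * ρ (u x)) U := by
    intro T hT
    induction hT using Submodule.span_induction with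
    | mem T hT =>
      obtain ⟨g, hg, rfl⟩ := hT
      exact (hρ.smooth.comp_contMDiffOn (hR g hg)).congr fun x _ => by
        simp only [Function.comp_apply, map_mul]
    | zero => simpa only [mul_zero, zero_mul] using contMDiffOn_const
    | add T T' _ _ ih ih' =>
      exact (ih.add ih').congr fun x _ => by rw [mul_add, add_mul, Pi.add_apply]
    | smul c T _ ih =>
      exact (((c • ContinuousLinearMap.id ℂ (V →L[ℂ] V)).restrictScalars ℝ).contMDiff
        |>.comp_contMDiffOn ih).congr fun x _ => by rw [mul_smul_comm, smul_mul_assoc]; rfl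
  refine fun x hx => (hρ.contMDiffAt (hcont.continuousAt (hU.mem_nhds hx)) ?_).contMDiffWithinAt
  simpa only [map_mul] using (hconj _ hspan).contMDiffAt (hU.mem_nhds hx)

end ImmersiveRep

section Frame

variable
    {EG HG EP HP ES HS : Type*}
    [NormedAddCommGroup EG] [NormedSpace ℝ EG] [TopologicalSpace HG]
    [NormedAddCommGroup EP] [NormedSpace ℝ EP] [TopologicalSpace HP]
    [NormedAddCommGroup ES] [NormedSpace ℝ ES] [TopologicalSpace HS]
    {IG : ModelWithCorners ℝ EG HG} {IP : ModelWithCorners ℝ EP HP} {IS : ModelWithCorners ℝ ES HS}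
    {G P S : Type*}
    [TopologicalSpace G] [ChartedSpace HG G] [Group G]
    [TopologicalSpace P] [ChartedSpace HP P]
    [TopologicalSpace S] [ChartedSpace HS S]
    {ξ : SmoothPrincipalBundle IG IP IS G P S}

open BundleAut

section Group

variable {A : Type*} [Group A] {γ : A →* BundleAut ξ} {p₀ : P}

variable (γ p₀) in
/-- The elements of `A` whose action on the base fixes the point below `p₀`. -/
noncomputable def periodSubgroup : Subgroup A :=
  (MulAction.stabilizer (BundleAut ξ) (ξ.proj p₀)).comap γ

theorem mem_periodSubgroup {a : A} :
    a ∈ periodSubgroup γ p₀ ↔ γ a • ξ.proj p₀ = ξ.proj p₀ := Iff.rfl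

theorem smul_proj_eq_smul_proj_iff {a b : A} :
    γ a • ξ.proj p₀ = γ b • ξ.proj p₀ ↔ b⁻¹ * a ∈ periodSubgroup γ p₀ := by
  rw [mem_periodSubgroup, map_mul, map_inv, mul_smul, inv_smul_eq_iff]

theorem exists_act_eq_smul (l : periodSubgroup γ p₀) : ∃ g, ξ.act p₀ g = γ l • p₀ :=
  SmoothPrincipalBundle.exists_act_eq (by rw [proj_smul]; exact l.2.symm)

variable (γ p₀) in
/-- The holonomy homomorphism `h`, determined by `p₀ · h(l) = γ(l) p₀`. -/
noncomputable def holonomy : periodSubgroup γ p₀ →* G where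
  toFun l := (exists_act_eq_smul l).choose
  map_one' := SmoothPrincipalBundle.act_injective p₀ <| by
    rw [(exists_act_eq_smul _).choose_spec, ξ.act_one, Subgroup.coe_one, map_one, one_smul]
  map_mul' l m := SmoothPrincipalBundle.act_injective p₀ <| by
    rw [ξ.act_mul, (exists_act_eq_smul _).choose_spec, (exists_act_eq_smul l).choose_spec,
      ← smul_act, (exists_act_eq_smul m).choose_spec, ← mul_smul, ← map_mul, Subgroup.coe_mul]

theorem act_holonomy (l : periodSubgroup γ p₀) : ξ.act p₀ (holonomy γ p₀ l) = γ l • p₀ :=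
  (exists_act_eq_smul l).choose_spec

variable (γ p₀) in
/-- The parametrization `(a, g) ↦ γ(a) p₀ · g` of the total space. -/
noncomputable def frameMap (x : A × G) : P := ξ.act (γ x.1 • p₀) x.2

theorem continuous_frameMap [TopologicalSpace A] [LocallyCompactSpace P] (hγ : Continuous γ) :
    Continuous (frameMap γ p₀) :=
  ξ.continuous_act.comp (((hγ.comp continuous_fst).smul continuous_const).prodMk continuous_snd)

theorem exists_mem_frameMap_eq {D : Set A} (hD : ∀ b, ∃ d ∈ D, γ d • ξ.proj p₀ = b) (q : P) :
    ∃ d ∈ D, ∃ g, frameMap γ p₀ (d, g) = q := by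
  obtain ⟨d, hd, hdq⟩ := hD (ξ.proj q)
  exact ⟨d, hd, SmoothPrincipalBundle.exists_act_eq ((proj_smul _ _).trans hdq)⟩

theorem surjective_frameMap {D : Set A} (hD : ∀ b, ∃ d ∈ D, γ d • ξ.proj p₀ = b) :
    Function.Surjective (frameMap γ p₀) := fun q =>
  let ⟨d, _, g, hdg⟩ := exists_mem_frameMap_eq hD q
  ⟨(d, g), hdg⟩

theorem smul_frameMap (a b : A) (g : G) :
    γ a • frameMap γ p₀ (b, g) = frameMap γ p₀ (a * b, g) := by
  rw [frameMap, frameMap, smul_act, map_mul, mul_smul]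

theorem act_frameMap (a : A) (g g' : G) :
    ξ.act (frameMap γ p₀ (a, g)) g' = frameMap γ p₀ (a, g * g') :=
  (ξ.act_mul _ _ _).symm

theorem proj_frameMap (a : A) (g : G) : ξ.proj (frameMap γ p₀ (a, g)) = γ a • ξ.proj p₀ :=
  (ξ.proj_act _ _).trans (proj_smul _ _)

theorem frameMap_mul_period (a : A) (l : periodSubgroup γ p₀) (g : G) :
    frameMap γ p₀ (a * l, g) = frameMap γ p₀ (a, holonomy γ p₀ l * g) := by
  simp only [frameMap, map_mul, mul_smul, ← act_holonomy, smul_act, ξ.act_mul]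

theorem frameMap_eq_iff {a b : A} {g g' : G} :
    frameMap γ p₀ (a, g) = frameMap γ p₀ (b, g') ↔
      ∃ l : periodSubgroup γ p₀, a = b * l ∧ holonomy γ p₀ l * g = g' := by
  constructor
  · intro h
    have hl : b⁻¹ * a ∈ periodSubgroup γ p₀ := by
      rw [← smul_proj_eq_smul_proj_iff, ← proj_frameMap a g, h, proj_frameMap]
    have ha : a = b * (⟨b⁻¹ * a, hl⟩ : periodSubgroup γ p₀) := (mul_inv_cancel_left b a).symm
    rw [ha, frameMap_mul_period] at h
    exact ⟨_, ha, SmoothPrincipalBundle.act_injective _ h⟩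
  · rintro ⟨l, rfl, rfl⟩
    exact frameMap_mul_period b l g

/-- For `η` in the centralizer of the holonomy, the gauge transformation
`γ(a) p₀ · g ↦ γ(a) p₀ · ηg`, written so that equivariance and the covering of the identity are
visible for every `η`. -/
noncomputable def twist (hγ : Function.Surjective (frameMap γ p₀)) (η : G) (q : P) : P :=
  ξ.act q ((Function.surjInv hγ q).2⁻¹ * η * (Function.surjInv hγ q).2)

variable {hγ : Function.Surjective (frameMap γ p₀)} {η η' : G}

theorem twist_frameMap (hη : ∀ l, Commute η (holonomy γ p₀ l)) (a : A) (g : G) :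
    twist hγ η (frameMap γ p₀ (a, g)) = frameMap γ p₀ (a, η * g) := by
  have hx := Function.surjInv_eq hγ (frameMap γ p₀ (a, g))
  rw [twist, act_frameMap]
  generalize Function.surjInv hγ (frameMap γ p₀ (a, g)) = x at hx ⊢
  obtain ⟨l, -, rfl⟩ := frameMap_eq_iff.1 hx
  rw [mul_assoc x.2⁻¹, mul_assoc, mul_inv_cancel_left, ← mul_assoc, ← mul_assoc, (hη l).eq]

theorem proj_twist (q : P) : ξ.proj (twist hγ η q) = ξ.proj q := ξ.proj_act _ _

theorem twist_act (hη : ∀ l, Commute η (holonomy γ p₀ l)) (q : P) (g : G) :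
    twist hγ η (ξ.act q g) = ξ.act (twist hγ η q) g := by
  obtain ⟨⟨a, g'⟩, rfl⟩ := hγ q
  rw [act_frameMap, twist_frameMap hη, twist_frameMap hη, act_frameMap, mul_assoc]

theorem smul_twist (hη : ∀ l, Commute η (holonomy γ p₀ l)) (a : A) (q : P) :
    γ a • twist hγ η q = twist hγ η (γ a • q) := by
  obtain ⟨⟨b, g⟩, rfl⟩ := hγ q
  rw [smul_frameMap, twist_frameMap hη, twist_frameMap hη, smul_frameMap]

theorem twist_mul (hη : ∀ l, Commute η (holonomy γ p₀ l))
    (hη' : ∀ l, Commute η' (holonomy γ p₀ l)) (q : P) :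
    twist hγ (η * η') q = twist hγ η (twist hγ η' q) := by
  obtain ⟨⟨a, g⟩, rfl⟩ := hγ q
  rw [twist_frameMap hη', twist_frameMap hη, twist_frameMap fun l => (hη l).mul_left (hη' l),
    mul_assoc]

theorem twist_one (q : P) : twist hγ 1 q = q := by
  rw [twist, mul_one, inv_mul_cancel, ξ.act_one]

end Group

variable {A : Type*} [CommGroup A] {γ : A →* BundleAut ξ} {p₀ : P}
    {hγ : Function.Surjective (frameMap γ p₀)} {η : G}

theorem twist_holonomy (l : periodSubgroup γ p₀) (q : P) :
    twist hγ (holonomy γ p₀ l) q = γ l • q := by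
  obtain ⟨⟨a, g⟩, rfl⟩ := hγ q
  rw [twist_frameMap fun m => (Commute.all _ _).map _, smul_frameMap, mul_comm,
    frameMap_mul_period]

variable [IsTopologicalGroup G]

variable (γ p₀) in
/-- The closure of the holonomy group. -/
noncomputable def holonomyClosure : Subgroup G := (holonomy γ p₀).range.topologicalClosure

variable (γ p₀) in
/-- The holonomy homomorphism with values in the closure of its range. -/
noncomputable def holonomyToClosure : periodSubgroup γ p₀ →* holonomyClosure γ p₀ :=
  (holonomy γ p₀).codRestrict _ fun l => Subgroup.le_topologicalClosure _ ⟨l, rfl⟩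

theorem isClosed_holonomyClosure : IsClosed (holonomyClosure γ p₀ : Set G) :=
  Subgroup.isClosed_topologicalClosure _

theorem denseRange_holonomyToClosure : DenseRange (holonomyToClosure γ p₀) := by
  refine Topology.IsInducing.subtypeVal.dense_iff.2 fun η => ?_
  rw [← Set.range_comp]
  exact η.2

variable [T2Space G]

noncomputable instance : CommGroup (holonomyClosure γ p₀) :=
  Subgroup.commGroupTopologicalClosure _ <| by
    rintro ⟨_, l, rfl⟩ ⟨_, m, rfl⟩
    exact Subtype.ext ((Commute.all l m).map (holonomy γ p₀))

theorem commute_holonomy (η : holonomyClosure γ p₀) (l : periodSubgroup γ p₀) :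
    Commute (η : G) (holonomy γ p₀ l) :=
  congrArg Subtype.val (mul_comm η (holonomyToClosure γ p₀ l))

theorem continuous_twist [TopologicalSpace A] [CompactSpace G] [T2Space P] [LocallyCompactSpace P]
    (hcont : Continuous γ) {D : Set A} (hDc : IsCompact D)
    (hD : ∀ b, ∃ d ∈ D, γ d • ξ.proj p₀ = b) :
    Continuous fun x : holonomyClosure γ p₀ × P => twist hγ (x.1 : G) x.2 := by
  have : CompactSpace D := isCompact_iff_compactSpace.1 hDc
  have : CompactSpace (holonomyClosure γ p₀) :=
    isCompact_iff_compactSpace.1 isClosed_holonomyClosure.isCompact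
  let Ψ : holonomyClosure γ p₀ × (D × G) → holonomyClosure γ p₀ × P :=
    Prod.map id fun x => frameMap γ p₀ (x.1, x.2)
  have hΨ : Continuous Ψ :=
    continuous_id.prodMap ((continuous_frameMap hcont).comp (by fun_prop))
  have hquot : Topology.IsQuotientMap Ψ := by
    refine hΨ.isClosedMap.isQuotientMap hΨ fun ⟨η, q⟩ => ?_
    obtain ⟨d, hd, g, rfl⟩ := exists_mem_frameMap_eq hD q
    exact ⟨(η, ⟨d, hd⟩, g), rfl⟩
  have htwist : (fun x : holonomyClosure γ p₀ × P => twist hγ (x.1 : G) x.2) ∘ Ψ =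
      fun x => frameMap γ p₀ (x.2.1, x.1 * x.2.2) :=
    funext fun x => twist_frameMap (commute_holonomy x.1) _ _
  rw [hquot.continuous_iff, htwist]
  exact (continuous_frameMap hcont).comp (by fun_prop)

theorem contMDiff_twist [LieGroup IG ∞ G] {V : Type*} [NormedAddCommGroup V]
    [InnerProductSpace ℂ V] [FiniteDimensional ℂ V] {ρ : G →* (V →L[ℂ] V)}
    (hρ : IsImmersiveRep IG ρ) (η : holonomyClosure γ p₀) (hcont : Continuous (twist hγ (η : G))) :
    ContMDiff IP IP ∞ (twist hγ (η : G)) := by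
  refine SmoothPrincipalBundle.contMDiff_act_self_of_unitSection
    (twist_act (hγ := hγ) (commute_holonomy η)) fun e he => ?_
  refine hρ.contMDiffOn_conj_of_mem_closure e.open_baseSet ?_ η.2
    (he.continuousOn_comp_unitSection hcont)
  rintro _ ⟨l, rfl⟩
  have htwist : ContMDiff IP IP ∞ (twist hγ (holonomy γ p₀ l)) :=
    (γ l).toDiffeo.contMDiff.congr (twist_holonomy l)
  exact he.contMDiffOn_comp_unitSection htwist

/-- The action of the closure of the holonomy group on the bundle by twists. -/
noncomputable def twistHom
    (hsmooth : ∀ η : holonomyClosure γ p₀, ContMDiff IP IP ∞ (twist hγ (η : G))) :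
    holonomyClosure γ p₀ →* BundleAut ξ where
  toFun η :=
    { toDiffeo :=
        { toFun := twist hγ (η : G)
          invFun := twist hγ ((η⁻¹ : holonomyClosure γ p₀) : G)
          left_inv q := by
            rw [← twist_mul (commute_holonomy _) (commute_holonomy _), ← Subgroup.coe_mul,
              inv_mul_cancel, Subgroup.coe_one, twist_one]
          right_inv q := by
            rw [← twist_mul (commute_holonomy _) (commute_holonomy _), ← Subgroup.coe_mul,
              mul_inv_cancel, Subgroup.coe_one, twist_one]
          contMDiff_toFun := hsmooth η
          contMDiff_invFun := hsmooth η⁻¹ }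
      baseDiffeo := Diffeomorph.refl IS S ∞
      map_act := twist_act (hγ := hγ) (commute_holonomy η)
      covers := proj_twist (hγ := hγ) }
  map_one' := ext_total (twist_one (hγ := hγ))
  map_mul' η η' := ext_total (twist_mul (hγ := hγ) (commute_holonomy η) (commute_holonomy η'))

/-- The homomorphism `(a, η) ↦ γ(a) φ_η`, where `φ_η` is the twist by `η`. -/
noncomputable def frameHom
    (hsmooth : ∀ η : holonomyClosure γ p₀, ContMDiff IP IP ∞ (twist hγ (η : G))) :
    A × holonomyClosure γ p₀ →* BundleAut ξ :=
  γ.noncommCoprod (twistHom hsmooth) fun a η =>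
    ext_total (smul_twist (hγ := hγ) (commute_holonomy η) a)

variable {hsmooth : ∀ η : holonomyClosure γ p₀, ContMDiff IP IP ∞ (twist hγ (η : G))}

theorem frameHom_smul (x : A × holonomyClosure γ p₀) (q : P) :
    frameHom hsmooth x • q = γ x.1 • twist hγ (x.2 : G) q := rfl

theorem frameHom_mk_one (a : A) : frameHom hsmooth (a, 1) = γ a :=
  ext_total fun q => congrArg (γ a • ·) (twist_one (hγ := hγ) q)

theorem continuous_frameHom [TopologicalSpace A] [LocallyCompactSpace P] (hcont : Continuous γ)
    (htwist : Continuous fun x : holonomyClosure γ p₀ × P => twist hγ (x.1 : G) x.2) :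
    Continuous (frameHom hsmooth) :=
  continuous_of_continuous_smul <| (hcont.comp (continuous_fst.comp continuous_fst)).smul
    (htwist.comp ((continuous_snd.comp continuous_fst).prodMk continuous_snd))

theorem frameHom_smul_frameMap (x : A × holonomyClosure γ p₀) (a : A) (g : G) :
    frameHom hsmooth x • frameMap γ p₀ (a, g) = frameMap γ p₀ (x.1 * a, x.2 * g) := by
  rw [frameHom_smul, twist_frameMap (commute_holonomy x.2), smul_frameMap]

theorem frameHom_eq_one_iff {x : A × holonomyClosure γ p₀} :
    frameHom hsmooth x = 1 ↔
      ∃ l : periodSubgroup γ p₀, x.1 = l ∧ holonomyToClosure γ p₀ l * x.2 = 1 := by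
  constructor
  · intro h
    have hp₀ := frameHom_smul_frameMap (hsmooth := hsmooth) x 1 1
    rw [h, one_smul, eq_comm, frameMap_eq_iff, mul_one, mul_one] at hp₀
    obtain ⟨l, hl, hlx⟩ := hp₀
    exact ⟨l, hl.trans (one_mul _), Subtype.ext hlx⟩
  · rintro ⟨l, hl, hlx⟩
    refine ext_total fun q => ?_
    obtain ⟨⟨a, g⟩, rfl⟩ := hγ q
    refine (frameHom_smul_frameMap x a g).trans ?_
    have hcancel : holonomy γ p₀ l * x.2 = 1 := congrArg Subtype.val hlx
    rw [hl, mul_comm, frameMap_mul_period, ← mul_assoc, hcancel, one_mul]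
    rfl

end Frame

section GraphQuotient

theorem eq_one_of_zpow_eq_one {W M : Type*} [AddCommGroup W] [Module ℝ W] [CommGroup M]
    (χ : Multiplicative W →* M) {k : ℤ} (hk : k ≠ 0) (hχ : ∀ w, χ w ^ k = 1) : χ = 1 := by
  refine MonoidHom.ext fun w => ?_
  have hw : w = Multiplicative.ofAdd ((k : ℝ)⁻¹ • w.toAdd) ^ k := by
    rw [← ofAdd_zsmul, ← Int.cast_smul_eq_zsmul ℝ, smul_inv_smul₀ (Int.cast_ne_zero.2 hk),
      ofAdd_toAdd]
  rw [hw, map_zpow, hχ, MonoidHom.one_apply]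

theorem apply_mk_one_eq_one_of_zpow {W H M : Type*} [AddCommGroup W] [Module ℝ W]
    [TopologicalSpace W] [CommGroup H] [TopologicalSpace H] [CommGroup M] [TopologicalSpace M]
    (χ : Multiplicative W × H →ₜ* M) {k : ℤ} (hk : k ≠ 0) (hχ : ∀ x, χ x ^ k = 1)
    (w : Multiplicative W) : χ (w, 1) = 1 :=
  DFunLike.congr_fun
    (eq_one_of_zpow_eq_one (χ.toMonoidHom.comp (.inl _ _)) hk fun w => hχ (w, 1)) w

section LatticeGraph

variable {W : Type*} [NormedAddCommGroup W] [NormedSpace ℝ W] [FiniteDimensional ℝ W]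
    (L : Submodule ℤ W) [DiscreteTopology L] [IsZLattice ℝ L]
    {H : Type*} [CommGroup H] [TopologicalSpace H]

-- A character `χ` of `H` gives the character `(w, η) ↦ ψ(w) χ(η)`, where `ψ` extends `χ ∘ h`.
theorem exists_finite_characters_mem_graph_iff (h : Multiplicative L →* H)
    {s : Set (H →ₜ* Circle)} (hs : s.Finite) (hsep : ∀ η, (∀ χ ∈ s, χ η = 1) → η = 1) :
    ∃ t : Set (Multiplicative W × H →ₜ* Circle), t.Finite ∧ ∀ x,
      (∃ l : L, x.1 = Multiplicative.ofAdd (l : W) ∧ h (Multiplicative.ofAdd l) * x.2 = 1) ↔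
        ∀ χ ∈ t, χ x = 1 := by
  choose ψ hψ using fun χ : H →ₜ* Circle => exists_character_extension L (χ.toMonoidHom.comp h)
  obtain ⟨r, hr, hrL⟩ := exists_finite_characters_mem_iff L
  let X (χ : H →ₜ* Circle) : Multiplicative W × H →ₜ* Circle :=
    (ψ χ).comp (.fst _ _) * χ.comp (.snd _ _)
  have hX (χ : H →ₜ* Circle) (l : L) (η : H) :
      X χ (Multiplicative.ofAdd (l : W), η) = χ (h (Multiplicative.ofAdd l) * η) := by
    rw [map_mul]
    exact congrArg (· * χ η) (hψ χ l)
  refine ⟨X '' s ∪ (fun χ => χ.comp (.fst _ _)) '' r, (hs.image X).union (hr.image _),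
    fun ⟨w, η⟩ => ?_⟩
  simp only [Set.mem_union, or_imp, forall_and, Set.forall_mem_image]
  constructor
  · rintro ⟨l, rfl : w = _, hl⟩
    exact ⟨fun χ _ => by rw [hX, hl, map_one], (hrL l).1 l.2⟩
  · rintro ⟨hη, hw⟩
    exact ⟨⟨w.toAdd, (hrL _).2 hw⟩, rfl,
      hsep _ fun χ hχ => (hX χ ⟨w.toAdd, (hrL _).2 hw⟩ η).symm.trans (hη hχ)⟩

end LatticeGraph

variable {E : Type*} [NormedAddCommGroup E] [NormedSpace ℝ E]
    {H B : Type*} [CommGroup H] [TopologicalSpace H] [Group B] [TopologicalSpace B]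

/-- The homomorphism `(w, η) ↦ τ (w, η)` for `w` in a subspace. -/
def restrictFst (τ : Multiplicative E × H →ₜ* B) (W : Submodule ℝ E) :
    Multiplicative W × H →ₜ* B :=
  τ.comp (ContinuousMonoidHom.prodMap
    ⟨AddMonoidHom.toMultiplicative W.subtype.toAddMonoidHom, continuous_subtype_val⟩ (.id H))

variable {Λ : Subgroup (Multiplicative E)} {h : Λ →* H} {τ : Multiplicative E × H →ₜ* B}
    (hker : ∀ x, τ x = 1 ↔ ∃ l : Λ, x.1 = l ∧ h l * x.2 = 1)
    {W : Submodule ℝ E} (hW : IsCompl (lineality (Subgroup.toAddSubgroup' Λ)) W)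
    {D : Set E}

include hker

omit [NormedSpace ℝ E] in
theorem exists_apply_eq_of_sub_mem {z w : E} (hzw : Multiplicative.ofAdd (z - w) ∈ Λ) (η : H) :
    ∃ η', τ (Multiplicative.ofAdd w, η') = τ (Multiplicative.ofAdd z, η) := by
  have hperiod : τ (Multiplicative.ofAdd (z - w), (h ⟨_, hzw⟩)⁻¹) = 1 :=
    (hker _).2 ⟨⟨_, hzw⟩, rfl, mul_inv_cancel _⟩
  refine ⟨η * h ⟨_, hzw⟩, ?_⟩
  rw [← mul_one (τ _), ← hperiod, ← map_mul, Prod.mk_mul_mk, ← ofAdd_add, add_sub_cancel,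
    mul_inv_cancel_right]

theorem restrictFst_eq_one_iff (x : Multiplicative W × H) :
    restrictFst τ W x = 1 ↔
      ∃ l : ((Subgroup.toAddSubgroup' Λ).comap W.subtype.toAddMonoidHom).toIntSubmodule,
        x.1 = Multiplicative.ofAdd (l : W) ∧
          h ⟨Multiplicative.ofAdd ((l : W) : E), l.2⟩ * x.2 = 1 := by
  refine (hker _).trans ⟨?_, ?_⟩
  · rintro ⟨l, hl, hlx⟩
    have hx : Multiplicative.ofAdd (x.1.toAdd : E) = l := hl
    obtain ⟨z, hz⟩ := l
    subst hx
    exact ⟨⟨x.1.toAdd, hz⟩, rfl, hlx⟩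
  · rintro ⟨l, hl, hlx⟩
    exact ⟨⟨Multiplicative.ofAdd ((l : W) : E), l.2⟩,
      congrArg (fun w : Multiplicative W => Multiplicative.ofAdd (w.toAdd : E)) hl, hlx⟩

include hW

theorem exists_finite_characters_restrictFst_eq_one_iff [FiniteDimensional ℝ E]
    (hΛ : IsClosed (Λ : Set (Multiplicative E)))
    (hD : IsCompact D) (hDΛ : ∀ z, ∃ d ∈ D, Multiplicative.ofAdd (z - d) ∈ Λ)
    {s : Set (H →ₜ* Circle)} (hs : s.Finite) (hsep : ∀ η, (∀ χ ∈ s, χ η = 1) → η = 1) :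
    ∃ t : Set (Multiplicative W × H →ₜ* Circle), t.Finite ∧
      ∀ x, restrictFst τ W x = 1 ↔ ∀ χ ∈ t, χ x = 1 := by
  let L := ((Subgroup.toAddSubgroup' Λ).comap W.subtype.toAddMonoidHom).toIntSubmodule
  have : DiscreteTopology L :=
    discreteTopology_comap_of_isCompl_lineality (Λ := Subgroup.toAddSubgroup' Λ) hΛ hW
  obtain ⟨D', hD', hD'Λ⟩ := exists_isCompact_comap_of_isCompl_lineality hW hD hDΛ
  have : IsZLattice ℝ L := isZLattice_of_isCompact hD' hD'Λ
  let h' : Multiplicative L →* H := h.comp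
    { toFun l := ⟨Multiplicative.ofAdd ((l.toAdd : W) : E), l.toAdd.2⟩
      map_one' := rfl
      map_mul' _ _ := rfl }
  obtain ⟨t, ht, htL⟩ := exists_finite_characters_mem_graph_iff L h' hs hsep
  exact ⟨t, ht, fun x => (restrictFst_eq_one_iff hker x).trans (htL x)⟩

omit hker in
theorem exists_eq_mul_of_isCompl_lineality (l : Λ) :
    ∃ (v : lineality (Subgroup.toAddSubgroup' Λ)) (w : W)
      (hw : Multiplicative.ofAdd (w : E) ∈ Λ),
      l = ⟨Multiplicative.ofAdd (v : E), mem_of_mem_lineality v.2⟩ * ⟨_, hw⟩ := by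
  let w := W.projectionOnto _ hW.symm (l : Multiplicative E).toAdd
  have hv := sub_projectionOnto_mem hW (l : Multiplicative E).toAdd
  have hw := (Subgroup.toAddSubgroup' Λ).sub_mem l.2 (mem_of_mem_lineality hv)
  refine ⟨⟨_, hv⟩, w, ?_, Subtype.ext (sub_add_cancel (l : Multiplicative E).toAdd (w : E)).symm⟩
  exact (sub_sub_cancel (l : Multiplicative E).toAdd (w : E)) ▸ hw

theorem apply_one_mk_eq_one_of_zpow {χ : Multiplicative W × H →ₜ* Circle}
    (hχ : ∀ x, restrictFst τ W x = 1 → χ x = 1) {k : ℤ} (hk : k ≠ 0) (hχk : ∀ x, χ x ^ k = 1)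
    (l : Λ) : χ (1, h l) = 1 := by
  obtain ⟨v, w, hw, rfl⟩ := exists_eq_mul_of_isCompl_lineality hW l
  let hV : Multiplicative (lineality (Subgroup.toAddSubgroup' Λ)) →* H := h.comp
    { toFun v := ⟨Multiplicative.ofAdd (v.toAdd : E), mem_of_mem_lineality v.toAdd.2⟩
      map_one' := rfl
      map_mul' _ _ := rfl }
  have hχv : χ (1, hV (Multiplicative.ofAdd v)) = 1 := DFunLike.congr_fun
    (eq_one_of_zpow_eq_one ((χ.toMonoidHom.comp (.inr _ _)).comp hV) hk fun v => hχk (1, hV v))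
    (Multiplicative.ofAdd v)
  have hχw : χ (Multiplicative.ofAdd w, (h ⟨_, hw⟩)⁻¹) = 1 :=
    hχ _ ((hker _).2 ⟨⟨_, hw⟩, rfl, mul_inv_cancel _⟩)
  have hχw' : χ (Multiplicative.ofAdd w, 1) = 1 := apply_mk_one_eq_one_of_zpow χ hk hχk _
  calc χ (1, h (_ * ⟨_, hw⟩))
      = χ (1, hV (Multiplicative.ofAdd v)) *
          (χ (Multiplicative.ofAdd w, 1) / χ (Multiplicative.ofAdd w, (h ⟨_, hw⟩)⁻¹)) := by
        rw [← map_div, ← map_mul, Prod.mk_div_mk, Prod.mk_mul_mk, div_self', one_mul, one_div,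
          inv_inv, map_mul]
        rfl
    _ = 1 := by rw [hχv, hχw, hχw', div_one, one_mul]

theorem eq_one_of_zpow_eq_one_of_restrictFst (hh : DenseRange h)
    {χ : Multiplicative W × H →ₜ* Circle} (hχ : ∀ x, restrictFst τ W x = 1 → χ x = 1)
    {k : ℤ} (hk : k ≠ 0) (hχk : χ ^ k = 1) : χ = 1 := by
  have hχk' (x : Multiplicative W × H) : χ x ^ k = 1 :=
    (map_zpow (evalCharacter x) χ k).symm.trans (by rw [hχk, map_one])
  have hsnd : (fun η => χ (1, η)) = fun _ => 1 :=
    hh.equalizer (by fun_prop) continuous_const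
      (funext (apply_one_mk_eq_one_of_zpow hker hW hχ hk hχk'))
  refine DFunLike.ext _ _ fun x => ?_
  calc χ x = χ (x.1, 1) * χ (1, x.2) := by
        rw [← map_mul, Prod.mk_mul_mk, mul_one, one_mul]
    _ = 1 := by
        rw [apply_mk_one_eq_one_of_zpow χ hk hχk', congrFun hsnd x.2, one_mul]

theorem exists_isCompact_restrictFst [FiniteDimensional ℝ E] [CompactSpace H]
    (hD : IsCompact D) (hDΛ : ∀ z, ∃ d ∈ D, Multiplicative.ofAdd (z - d) ∈ Λ) :
    ∃ C : Set (Multiplicative W × H), IsCompact C ∧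
      ∀ x, ∃ c ∈ C, restrictFst τ W c = τ x := by
  obtain ⟨D', hD', hD'Λ⟩ := exists_isCompact_comap_of_isCompl_lineality hW hD hDΛ
  refine ⟨(Multiplicative.toAdd ⁻¹' D') ×ˢ Set.univ, hD'.prod isCompact_univ, fun ⟨z, η⟩ => ?_⟩
  let w := W.projectionOnto (lineality (Subgroup.toAddSubgroup' Λ)) hW.symm z.toAdd
  obtain ⟨d, hd, hdΛ⟩ := hD'Λ w
  have hzd := (Subgroup.toAddSubgroup' Λ).add_mem
    (mem_of_mem_lineality (sub_projectionOnto_mem hW z.toAdd)) hdΛ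
  obtain ⟨η', hη'⟩ := exists_apply_eq_of_sub_mem hker (z := z.toAdd) (w := d)
    (by rwa [sub_add_sub_cancel] at hzd) η
  exact ⟨(Multiplicative.ofAdd d, η'), ⟨hd, trivial⟩, hη'⟩

omit hW

theorem isCompact_range_and_isTorusGroup_range [FiniteDimensional ℝ E] [CompactSpace H] [T2Space B]
    (hΛ : IsClosed (Λ : Set (Multiplicative E))) (hh : DenseRange h)
    (hD : IsCompact D) (hDΛ : ∀ z, ∃ d ∈ D, Multiplicative.ofAdd (z - d) ∈ Λ)
    {s : Set (H →ₜ* Circle)} (hs : s.Finite) (hsep : ∀ η, (∀ χ ∈ s, χ η = 1) → η = 1) :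
    IsCompact (τ.toMonoidHom.range : Set B) ∧ IsTorusGroup τ.toMonoidHom.range := by
  obtain ⟨W, hW⟩ := (lineality (Subgroup.toAddSubgroup' Λ)).exists_isCompl
  obtain ⟨t, ht, hker'⟩ := exists_finite_characters_restrictFst_eq_one_iff hker hW hΛ hD hDΛ hs hsep
  obtain ⟨C, hC, hτC⟩ := exists_isCompact_restrictFst hker hW hD hDΛ
  have hrange : (restrictFst τ W).toMonoidHom.range = τ.toMonoidHom.range := by
    refine le_antisymm ?_ ?_
    · rintro _ ⟨x, rfl⟩
      exact ⟨_, rfl⟩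
    · rintro _ ⟨x, rfl⟩
      obtain ⟨c, -, hc⟩ := hτC x
      exact ⟨c, hc⟩
  have himage : restrictFst τ W '' C = τ.toMonoidHom.range := by
    refine subset_antisymm (hrange ▸ Set.image_subset_range _ _) ?_
    rintro _ ⟨x, rfl⟩
    exact hτC x
  refine ⟨himage ▸ hC.image (restrictFst τ W).continuous_toFun, hrange ▸ ?_⟩
  exact isTorusGroup_range (restrictFst τ W) ht hker'
    (fun χ hχ k hk => eq_one_of_zpow_eq_one_of_restrictFst hker hW hh hχ hk)
    hC fun x => hτC _

end GraphQuotient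

section Torus

open BundleAut

variable
    {EG HG EP HP ES HS : Type*}
    [NormedAddCommGroup EG] [NormedSpace ℝ EG] [TopologicalSpace HG]
    [NormedAddCommGroup EP] [NormedSpace ℝ EP] [TopologicalSpace HP]
    [NormedAddCommGroup ES] [NormedSpace ℝ ES] [TopologicalSpace HS]
    {IG : ModelWithCorners ℝ EG HG} {IP : ModelWithCorners ℝ EP HP} {IS : ModelWithCorners ℝ ES HS}
    {G P S : Type*}
    [TopologicalSpace G] [ChartedSpace HG G] [Group G]
    [TopologicalSpace P] [ChartedSpace HP P]
    [TopologicalSpace S] [ChartedSpace HS S]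
    {ξ : SmoothPrincipalBundle IG IP IS G P S}

section Group

variable {A : Type*} [Group A] [TopologicalSpace A] [LocallyCompactSpace P] [T2Space S]
    {γ : A →* BundleAut ξ} (hcont : Continuous γ)

include hcont

theorem isClosed_periodSubgroup (p₀ : P) : IsClosed (periodSubgroup γ p₀ : Set A) :=
  isClosed_eq (hcont.smul continuous_const) continuous_const

theorem exists_isCompact_forall_exists_smul_eq_of_transitive [IsTopologicalGroup A]
    [LocallyCompactSpace A] [SigmaCompactSpace A] [CompactSpace S]
    (htrans : ∀ b b' : S, ∃ a, γ a • b = b') (b₀ : S) :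
    ∃ D : Set A, IsCompact D ∧ ∀ b, ∃ d ∈ D, γ d • b₀ = b := by
  let _ : MulAction A S := MulAction.compHom S γ
  have : ContinuousSMul A S := ⟨(hcont.comp continuous_fst).smul continuous_snd⟩
  have : MulAction.IsPretransitive A S := ⟨htrans⟩
  exact exists_isCompact_forall_exists_smul_eq b₀

end Group

theorem isCompact_and_isTorusGroup_range_frameHom {E : Type*} [NormedAddCommGroup E]
    [NormedSpace ℝ E] [FiniteDimensional ℝ E] [IsTopologicalGroup G] [CompactSpace G] [T2Space G]
    [LocallyCompactSpace P] [T2Space P] [T2Space S] {γ : Multiplicative E →* BundleAut ξ} {p₀ : P}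
    {hγ : Function.Surjective (frameMap γ p₀)} (hcont : Continuous γ)
    {D : Set (Multiplicative E)} (hDc : IsCompact D) (hD : ∀ b, ∃ d ∈ D, γ d • ξ.proj p₀ = b)
    (hsmooth : ∀ η : holonomyClosure γ p₀, ContMDiff IP IP ∞ (twist hγ (η : G)))
    {s : Set (holonomyClosure γ p₀ →ₜ* Circle)} (hs : s.Finite)
    (hsep : ∀ η, (∀ χ ∈ s, χ η = 1) → η = 1) :
    IsCompact ((frameHom hsmooth).range : Set (BundleAut ξ)) ∧
      IsTorusGroup (frameHom hsmooth).range := by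
  have : CompactSpace (holonomyClosure γ p₀) :=
    isCompact_iff_compactSpace.1 isClosed_holonomyClosure.isCompact
  let τ : Multiplicative E × holonomyClosure γ p₀ →ₜ* BundleAut ξ :=
    ⟨frameHom hsmooth, continuous_frameHom hcont (continuous_twist hcont hDc hD)⟩
  have hDperiod (z : E) :
      ∃ d, Multiplicative.ofAdd d ∈ D ∧ Multiplicative.ofAdd (z - d) ∈ periodSubgroup γ p₀ := by
    obtain ⟨d, hd, hdz⟩ := hD (γ (Multiplicative.ofAdd z) • ξ.proj p₀)
    refine ⟨d.toAdd, hd, ?_⟩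
    rw [sub_eq_neg_add]
    exact smul_proj_eq_smul_proj_iff.1 hdz.symm
  exact isCompact_range_and_isTorusGroup_range (τ := τ) (fun _ => frameHom_eq_one_iff)
    (isClosed_periodSubgroup hcont p₀) denseRange_holonomyToClosure hDc hDperiod hs hsep

end Torus

theorem mainTheorem10_general
    {EG HG EP HP ES HS E : Type*}
    [NormedAddCommGroup EG] [NormedSpace ℝ EG] [FiniteDimensional ℝ EG] [TopologicalSpace HG]
    [NormedAddCommGroup EP] [NormedSpace ℝ EP] [TopologicalSpace HP]
    [NormedAddCommGroup ES] [NormedSpace ℝ ES] [TopologicalSpace HS]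
    [NormedAddCommGroup E] [NormedSpace ℝ E] [FiniteDimensional ℝ E]
    (IG : ModelWithCorners ℝ EG HG) [IG.Boundaryless]
    {IP : ModelWithCorners ℝ EP HP} {IS : ModelWithCorners ℝ ES HS}
    {G P S : Type*}
    [TopologicalSpace G] [ChartedSpace HG G] [Group G] [LieGroup IG ∞ G]
    [CompactSpace G] [T2Space G]
    [TopologicalSpace P] [ChartedSpace HP P] [LocallyCompactSpace P] [T2Space P]
    [TopologicalSpace S] [ChartedSpace HS S] [CompactSpace S] [T2Space S] [Nonempty S]
    (ξ : SmoothPrincipalBundle IG IP IS G P S) (γ : Multiplicative E →ₜ* BundleAut ξ)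
    (htrans : ∀ b b', ∃ z : E, (γ (Multiplicative.ofAdd z)).baseDiffeo b = b') :
    IsCompact (closure (Set.range γ)) ∧
      ∃ T : Subgroup (BundleAut ξ), IsClosed (T : Set (BundleAut ξ)) ∧ IsTorusGroup T ∧
        ∃ γT : Multiplicative E →ₜ* T, ∀ z, (γT z : BundleAut ξ) = γ z := by
  obtain ⟨p₀, -⟩ := BundleAut.proj_surjective ξ (Classical.arbitrary S)
  have : IsTopologicalGroup G := topologicalGroup_of_lieGroup IG ∞
  have : ProperSpace E := FiniteDimensional.proper_real E
  obtain ⟨D, hDc, hD⟩ := exists_isCompact_forall_exists_smul_eq_of_transitive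
    (A := Multiplicative E) γ.continuous_toFun htrans (ξ.proj p₀)
  obtain ⟨V, _, _, _, ρ, hρnorm, hρinj, hρ⟩ := exists_faithful_unitary_rep (G := G) IG
  have htwist := continuous_twist (hγ := surjective_frameMap hD) γ.continuous_toFun hDc hD
  have hsmooth (η : holonomyClosure γ.toMonoidHom p₀) :=
    contMDiff_twist hρ η (htwist.comp (Continuous.prodMk_right η))
  obtain ⟨s, hs, hsep⟩ := exists_finite_characters
    (ρ := ρ.comp (holonomyClosure γ.toMonoidHom p₀).subtype) (fun η v => hρnorm η v) fun v =>
      (hρ.smooth.continuous.clm_apply continuous_const).comp continuous_subtype_val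
  obtain ⟨hcompact, htorus⟩ := isCompact_and_isTorusGroup_range_frameHom γ.continuous_toFun hDc hD
    hsmooth hs fun η hη => Subtype.ext (hρinj ((hsep η hη).trans (map_one ρ).symm))
  have hmem (z : Multiplicative E) : γ z ∈ (frameHom hsmooth).range := ⟨(z, 1), frameHom_mk_one z⟩
  exact ⟨hcompact.of_isClosed_subset isClosed_closure
    (closure_minimal (Set.range_subset_iff.2 hmem) hcompact.isClosed),
    (frameHom hsmooth).range, hcompact.isClosed, htorus,
    ⟨γ.toMonoidHom.codRestrict _ hmem, γ.continuous_toFun.subtype_mk _⟩, fun _ => rfl⟩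

theorem mainTheorem10
    {EG HG EP HP ES HS : Type*}
    [NormedAddCommGroup EG] [NormedSpace ℝ EG] [FiniteDimensional ℝ EG] [TopologicalSpace HG]
    [NormedAddCommGroup EP] [NormedSpace ℝ EP] [FiniteDimensional ℝ EP] [TopologicalSpace HP]
    [NormedAddCommGroup ES] [NormedSpace ℝ ES] [FiniteDimensional ℝ ES] [TopologicalSpace HS]
    (IG : ModelWithCorners ℝ EG HG) [IG.Boundaryless]
    (IP : ModelWithCorners ℝ EP HP) [IP.Boundaryless]
    (IS : ModelWithCorners ℝ ES HS) [IS.Boundaryless]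
    {G P S : Type*}
    [TopologicalSpace G] [ChartedSpace HG G] [Group G] [LieGroup IG ∞ G]
    [CompactSpace G] [T2Space G]
    [TopologicalSpace P] [ChartedSpace HP P] [IsManifold IP ∞ P] [T2Space P]
    [TopologicalSpace S] [ChartedSpace HS S]
    (hS : IsGenusOneSurface IS S)
    (ξ : SmoothPrincipalBundle IG IP IS G P S)
    (γ : Multiplicative ℂ →ₜ* BundleAut ξ) (hγ : IsFrame γ) :
    IsCompact (closure (Set.range γ)) ∧
      ∃ T : Subgroup (BundleAut ξ), IsClosed (T : Set (BundleAut ξ)) ∧ IsTorusGroup T ∧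
        ∃ γT : Multiplicative ℂ →ₜ* T, ∀ z, (γT z : BundleAut ξ) = γ z := by
  obtain ⟨-, ⟨e⟩⟩ := hS
  have : CompactSpace S := e.toHomeomorph.symm.compactSpace
  have : T2Space S := e.toHomeomorph.symm.t2Space
  have : Nonempty S := ⟨e.symm (1, 1)⟩
  have : LocallyCompactSpace P := Manifold.locallyCompact_of_finiteDimensional IP
  exact mainTheorem10_general IG ξ γ hγ
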